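/- **Conventions.** A tree is a finite non-empty poset $T$ (of edges) with a unique minimal element (the root), such that the edges below any edge are totally ordered, together with a set of maximal elements (the leaves). Inner edges are the edges other than the root and the leaves. For a non-leaf edge $o$, the (possibly empty) set of its immediate successors is the vertex with output $o$. $\Omega$ is the category of trees (morphisms $S\to T$ are morphisms of the associated coloured operads $\Omega(S)\to\Omega(T)$), dendroidal sets are presheaves on $\Omega$, and $\Omega[T]$ is the presheaf represented by $T$. The elementary faces of $T$ are: the inner faces $\partial_eT$ (contract an inner edge $e$), the top faces $\partial_wT$ (chop off a vertex $w$ all of whose inputs are leaves; its output becomes a leaf) and the bottom faces $\partial_vT$ (chop off the bottom vertex $v$, if all its inputs except possibly one input $e$ are leaves; $e$ becomes the root; for a corolla, i.e. a tree with one vertex, there is one bottom face for each input $e$). Faces of $T$, including $T$ itself, are obtained by iterating elementary faces. $\Lambda^f[T]\subseteq\Omega[T]$ is the union of the images of all elementary faces of $T$ other than $\partial_f$. Operadic (inner), covariant and stable anodyne extensions are the smallest classes closed under pushouts, retracts and transfinite compositions that contain, respectively, the inner horn inclusions, the inner and top horn inclusions, and all horn inclusions $\Lambda^f[T]\to\Omega[T]$.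 A pair $\{\partial_e,\partial_v\}$ of elementary faces of a tree is *mixed* if $v$ is a top or bottom vertex and $e$ is the inner edge attached to it. Composable elementary face maps $Q\to P_1\to P$ form an *adjacent* pair if they are one of the two sides of a relation $\partial_w\partial_vP=\partial_{w\circ_e v}\partial_eP$ with $\{\partial_v,\partial_e\}$ a mixed pair of faces of $P$ (where $w\circ_e v$ is the vertex obtained from $v$ and $w$ by contracting $e$). Two different extensions $\partial_f\colon S\to P_1$, $\partial_g\colon S\to P_2$ are *bad* if $f,g$ are both top vertices, or both bottom vertices, attached to the same edge of $S$. For faces $P_1,P_2$ of a tree $R$, $P_1\cup P_2$ is the least face of $R$ having both as faces. **Theorem.** Let $R$ be a tree and $A\subseteq\Omega[R]$ a dendroidal subset. Call a face $P$ of $R$ missing if $\Omega[P]\to\Omega[R]$ does not factor through $A$. Let $F$ be a set of elementary face maps $\partial_f\colon\partial_fP\to P$ with $P$ a face of $R$ and $P,\partial_fP$ both missing, such that: * (F1) $F$ contains no mixed, adjacent or bad pair, and no two different faces of one corolla. * (F2) For every extension $\partial_g\colon P\to P'$ not in $F$ there is at most one extension $\partial_f\colon P\to P''$ in $F$ such that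 $\{\partial_f,\partial_g\}$ is bad. * (F3) For every commutative square of elementary face maps with corners $P,\ \partial_fP,\ \partial_gP,\ \partial_f\partial_gP=\partial_g\partial_fP$: if one of the two maps labelled $\partial_f$ and one of the two maps labelled $\partial_g$ are in $F$, then all four maps are in $F$. * (F4) For every $\partial_f\colon P\to P'$ in $F$ and every other extension $\partial_g\colon P\to P''$ ($P''$ a face of $R$, $P''\neq P'$), all elementary face maps in any sequence of elementary extensions leading from $P''$ to $P'\cup P''$ are in $F$. * (F5) Every missing face is the domain or the codomain of an element of $F$. Then $A\to\Omega[R]$ is a finite composition of inclusions $A=B_0\subseteq B_1\subseteq\dots\subseteq B_N=\Omega[R]$, each of which is a pushout of a horn inclusion $\Lambda^f[P]\to\Omega[P]$ with $(\partial_f\colon\partial_fP\to P)\in F$, where $\Omega[P]\to B_{i+1}\subseteq\Omega[R]$ is the face map. Hence $A\to\Omega[R]$ is a stable anodyne extension; it is a covariant anodyne extension if all elements of $F$ are inner or top face maps, and an operadic anodyne extension if all elements of $F$ are inner face maps. -/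

import Mathlib

open CategoryTheory Opposite

universe u

namespace Dendroidal

/-! ### Trees and the category of trees -/

/-- A (rooted, non-planar) tree: a finite partially ordered set of edges with a least element
(the root; on a finite poset this is the same as a unique minimal element), in which the edges
below any given edge are totally ordered, with a chosen set of maximal edges (the leaves). -/
structure DTree : Type (u + 1) where
  /-- the set of edges -/
  Edge : Type u
  [order : PartialOrder Edge]
  [finite : Finite Edge]
  /-- the set of leaves -/
  leaves : Set Edge
  exists_root : ∃ r : Edge, ∀ e : Edge, r ≤ e
  branch : ∀ e a b : Edge, a ≤ e → b ≤ e → a ≤ b ∨ b ≤ a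
  leaves_max : ∀ l ∈ leaves, IsMax l

attribute [instance] DTree.order DTree.finite

namespace DTree

/-- `e` is the output of a stump (an empty vertex): it is maximal but not a leaf. -/
def IsStumpOutput (T : DTree.{u}) (e : T.Edge) : Prop := IsMax e ∧ e ∉ T.leaves

/-- `(x₁, …, xₙ; t)` is an operation of `T`. The coloured operad `Ω(T)` has the edges of `T` as
colours, a single operation `(x₁, …, xₙ) → t` if this predicate holds, and none otherwise. -/
structure IsOperation (T : DTree.{u}) {n : ℕ} (x : Fin n → T.Edge) (t : T.Edge) : Prop where
  le : ∀ i, t ≤ x i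
  leaf : ∀ l ∈ T.leaves, t ≤ l → ∃! i, x i ≤ l
  stump : ∀ e, T.IsStumpOutput e → t ≤ e → ∀ i j, x i ≤ e → x j ≤ e → i = j

/-- A morphism `S ⟶ T` of trees is a morphism of coloured operads `Ω(S) → Ω(T)`. As every set of
operations of these operads is empty or a singleton, such a morphism is a map on colours which
sends operations to operations; all compatibilities with the operad structures are automatic. -/
@[ext]
structure Hom (S T : DTree.{u}) where
  toFun : S.Edge → T.Edge
  map_operation : ∀ (n : ℕ) (x : Fin n → S.Edge) (t : S.Edge),
    S.IsOperation x t → T.IsOperation (fun i => toFun (x i)) (toFun t)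

/-- The category `Ω` of trees. -/
instance : Category.{u} DTree.{u} where
  Hom := Hom
  id _ := ⟨fun e => e, fun _ _ _ h => h⟩
  comp f g := ⟨fun e => g.toFun (f.toFun e),
    fun n x t h => g.map_operation n _ _ (f.map_operation n x t h)⟩

theorem exists_max_ge (T : DTree.{u}) (e : T.Edge) : ∃ m, e ≤ m ∧ IsMax m := by
  obtain ⟨m, hm, hmax⟩ := (Set.toFinite (Set.Ici e)).exists_le_maximal (Set.mem_Ici.2 le_rfl)
  refine ⟨m, hm, fun b hb => hmax.2 (Set.mem_Ici.2 (le_trans hm hb)) hb⟩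

theorem IsOperation.antichain {T : DTree.{u}} {n : ℕ} {x : Fin n → T.Edge} {t : T.Edge}
    (h : T.IsOperation x t) {i j : Fin n} (hij : x i ≤ x j) : i = j := by
  obtain ⟨m, hm, hmax⟩ := T.exists_max_ge (x j)
  by_cases hl : m ∈ T.leaves
  · exact (h.leaf m hl ((h.le j).trans hm)).unique (hij.trans hm) hm
  · exact h.stump m ⟨hmax, hl⟩ ((h.le j).trans hm) i j (hij.trans hm) hm

theorem isOperation_of_antichain {T : DTree.{u}} {n : ℕ} {x : Fin n → T.Edge} {t : T.Edge}
    (hle : ∀ i, t ≤ x i) (hleaf : ∀ l ∈ T.leaves, t ≤ l → ∃ i, x i ≤ l)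
    (hanti : ∀ i j, x i ≤ x j → i = j) : T.IsOperation x t := by
  have key : ∀ e i j, x i ≤ e → x j ≤ e → i = j := fun e i j hi hj =>
    (T.branch e _ _ hi hj).elim (hanti i j) fun h => (hanti j i h).symm
  refine ⟨hle, fun l hl htl => ?_, fun e _ _ i j => key e i j⟩
  obtain ⟨i, hi⟩ := hleaf l hl htl
  exact ⟨i, hi, fun j hj => key l j i hj hi⟩

end DTree

/-! ### Subtrees and elementary faces -/

/-- A set of edges of `R` together with a set of leaves which, with the order induced from `R`,
form a tree. -/
@[ext]
structure Subtree (R : DTree.{u}) where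
  edges : Set R.Edge
  leaves : Set R.Edge
  leaves_subset : leaves ⊆ edges
  exists_root : ∃ r ∈ edges, ∀ e ∈ edges, r ≤ e
  leaves_max : ∀ l ∈ leaves, ∀ e ∈ edges, ¬ l < e

namespace Subtree

variable {R : DTree.{u}}

/-- A subtree, as a tree in its own right. -/
def toTree (P : Subtree R) : DTree.{u} where
  Edge := {e : R.Edge // e ∈ P.edges}
  leaves := {e | (e : R.Edge) ∈ P.leaves}
  exists_root := by
    obtain ⟨r, hr, h⟩ := P.exists_root
    exact ⟨⟨r, hr⟩, fun e => h e e.2⟩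
  branch e a b ha hb := R.branch e a b ha hb
  leaves_max l hl b hb := by
    rcases eq_or_lt_of_le (show (l : R.Edge) ≤ b from hb) with h | h
    · exact h.ge
    · exact (P.leaves_max l hl b b.2 h).elim

/-- The whole tree. -/
def whole (R : DTree.{u}) : Subtree R where
  edges := Set.univ
  leaves := R.leaves
  leaves_subset := Set.subset_univ _
  exists_root := by
    obtain ⟨r, h⟩ := R.exists_root
    exact ⟨r, trivial, fun e _ => h e⟩
  leaves_max l hl e _ h := (R.leaves_max l hl).not_lt h

/-- `r` is the root of `P`. -/
def IsRoot (P : Subtree R) (r : R.Edge) : Prop := r ∈ P.edges ∧ ∀ e ∈ P.edges, r ≤ e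

/-- Inner edges are the edges other than the root and the leaves. -/
def IsInner (P : Subtree R) (e : R.Edge) : Prop := e ∈ P.edges ∧ e ∉ P.leaves ∧ ¬ P.IsRoot e

/-- `v` is a vertex of `P` with output `o`: the edge `o` is not a leaf and `v` is the set of its
immediate successors in `P`. -/
def IsVertex (P : Subtree R) (o : R.Edge) (v : Set R.Edge) : Prop :=
  o ∈ P.edges ∧ o ∉ P.leaves ∧ v = {x ∈ P.edges | o < x ∧ ∀ y ∈ P.edges, ¬ (o < y ∧ y < x)}

/-- `P` has exactly one vertex. -/
def IsCorolla (P : Subtree R) : Prop := ∃! o : R.Edge, o ∈ P.edges ∧ o ∉ P.leaves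

end Subtree

/-- The possible indices `f` of an elementary face map `∂_f`: an inner edge `e`; a top vertex with
output `o` and set of inputs `w`; a bottom vertex with output `r`, set of inputs `v` and a chosen
input `e` (the edge that becomes the new root). -/
inductive FaceIndex (R : DTree.{u}) : Type u
  | inner (e : R.Edge)
  | top (o : R.Edge) (w : Set R.Edge)
  | bottom (r : R.Edge) (v : Set R.Edge) (e : R.Edge)

/-- `IsFaceAt f Q P`: the elementary face `∂_f P` exists and is equal to `Q`. -/
def IsFaceAt {R : DTree.{u}} : FaceIndex R → Subtree R → Subtree R → Prop
  | .inner e, Q, P => P.IsInner e ∧ Q.edges = P.edges \ {e} ∧ Q.leaves = P.leaves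
  | .top o w, Q, P => P.IsVertex o w ∧ w ⊆ P.leaves ∧
      Q.edges = P.edges \ w ∧ Q.leaves = (P.leaves \ w) ∪ {o}
  | .bottom r v e, Q, P => P.IsRoot r ∧ P.IsVertex r v ∧ e ∈ v ∧ (∀ x ∈ v, x ≠ e → x ∈ P.leaves) ∧
      Q.edges = {t ∈ P.edges | e ≤ t} ∧ Q.leaves = P.leaves \ (v \ {e})

/-- The three types of elementary face maps. -/
inductive FaceKind
  | inner
  | top
  | bottom

/-- The type of the elementary face map `∂_f`. -/
def FaceIndex.kind {R : DTree.{u}} : FaceIndex R → FaceKind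
  | .inner _ => .inner
  | .top _ _ => .top
  | .bottom _ _ _ => .bottom

/-- There is an elementary face map `Q → P` of type `k`. -/
def IsFaceOfKind {R : DTree.{u}} (k : FaceKind) (Q P : Subtree R) : Prop :=
  ∃ f : FaceIndex R, f.kind = k ∧ IsFaceAt f Q P

/-- There is an elementary face map `Q → P`. (It is determined by `Q` and `P`.) -/
def IsElementaryFace {R : DTree.{u}} (Q P : Subtree R) : Prop := ∃ f : FaceIndex R, IsFaceAt f Q P

/-- `Q` is a face of `P`: it is obtained from `P` by a (possibly empty) sequence of elementary
faces. -/
def IsFaceOf {R : DTree.{u}} (Q P : Subtree R) : Prop := Relation.ReflTransGen IsElementaryFace Q P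

/-- The faces of `R`. -/
def Face (R : DTree.{u}) : Type u := {P : Subtree R // IsFaceOf P (Subtree.whole R)}

/-! ### Face maps are morphisms of trees -/

section

variable {R : DTree.{u}}

/-- The inclusion of edges is a morphism of operads. -/
def InclIsHom (Q P : Subtree R) : Prop :=
  ∃ h : Q.edges ⊆ P.edges, ∀ (n : ℕ) (x : Fin n → Q.toTree.Edge) (t : Q.toTree.Edge),
    Q.toTree.IsOperation x t →
      P.toTree.IsOperation (fun i => (⟨(x i).1, h (x i).2⟩ : P.toTree.Edge)) ⟨t.1, h t.2⟩

theorem inclIsHom_of_leaves {Q P : Subtree R} (h : Q.edges ⊆ P.edges)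
    (hl : ∀ t ∈ Q.edges, ∀ l ∈ P.leaves, t ≤ l → ∃ l' ∈ Q.leaves, t ≤ l' ∧ l' ≤ l) :
    InclIsHom Q P := by
  refine ⟨h, fun n x t hx => DTree.isOperation_of_antichain (fun i => hx.le i) ?_
    fun i j hij => hx.antichain hij⟩
  intro l hlP htl
  obtain ⟨l', hl', htl', hll'⟩ := hl t.1 t.2 l.1 hlP htl
  obtain ⟨i, hi, -⟩ := hx.leaf ⟨l', Q.leaves_subset hl'⟩ hl' htl'
  have h1 : (x i).1 ≤ l' := hi
  exact ⟨i, h1.trans hll'⟩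

theorem IsElementaryFace.inclIsHom {Q P : Subtree R} (h : IsElementaryFace Q P) :
    InclIsHom Q P := by
  obtain ⟨f, hf⟩ := h
  cases f with
  | inner e =>
    obtain ⟨-, he, hl⟩ := hf
    exact inclIsHom_of_leaves (he ▸ Set.sdiff_subset)
      fun t _ l hlP htl => ⟨l, hl ▸ hlP, htl, le_rfl⟩
  | top o w =>
    obtain ⟨⟨ho, -, hw⟩, -, he, hl⟩ := hf
    refine inclIsHom_of_leaves (he ▸ Set.sdiff_subset) fun t ht l hlP htl => ?_
    rw [he] at ht
    by_cases hlw : l ∈ w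
    · refine ⟨o, hl ▸ Or.inr rfl, ?_, ?_⟩
      · have hlw' := hlw
        rw [hw] at hlw'
        obtain ⟨-, hol, hcov⟩ := hlw'
        rcases R.branch l t o htl hol.le with h1 | h1
        · exact h1
        · rcases eq_or_lt_of_le h1 with h2 | h2
          · exact h2.ge
          · rcases eq_or_lt_of_le htl with h3 | h3
            · exact (ht.2 (h3 ▸ hlw)).elim
            · exact (hcov t ht.1 ⟨h2, h3⟩).elim
      · rw [hw] at hlw
        exact hlw.2.1.le
    · exact ⟨l, hl ▸ Or.inl ⟨hlP, hlw⟩, htl, le_rfl⟩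
  | bottom r v e =>
    obtain ⟨-, ⟨-, -, hv⟩, hev, -, he, hl⟩ := hf
    refine inclIsHom_of_leaves (he ▸ Set.sep_subset _ _) fun t ht l hlP htl => ?_
    rw [he] at ht
    refine ⟨l, hl ▸ ⟨hlP, fun hlv => ?_⟩, htl, le_rfl⟩
    obtain ⟨hlv, hne⟩ := hlv
    rw [hv] at hev hlv
    exact hlv.2.2 e hev.1 ⟨hev.2.1, lt_of_le_of_ne (ht.2.trans htl) fun h => hne h.symm⟩

theorem IsFaceOf.inclIsHom {Q P : Subtree R} (h : IsFaceOf Q P) : InclIsHom Q P := by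
  induction h with
  | refl => exact ⟨subset_rfl, fun _ _ _ h => h⟩
  | tail _ h ih =>
    obtain ⟨h1, k1⟩ := ih
    obtain ⟨h2, k2⟩ := h.inclIsHom
    exact ⟨h1.trans h2, fun n x t hx => k2 n _ _ (k1 n x t hx)⟩

/-- The face map `Q ⟶ P` in `Ω` for a face `Q` of `P`. -/
def faceMap {Q P : Subtree R} (h : IsFaceOf Q P) : Q.toTree ⟶ P.toTree :=
  DTree.Hom.mk (fun e => ⟨e.1, h.inclIsHom.1 e.2⟩) h.inclIsHom.2

/-- The face map `P ⟶ R` in `Ω` for a face `P` of `R`. -/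
def Face.incl (P : Face R) : P.1.toTree ⟶ R :=
  DTree.Hom.mk (fun e => e.1) fun n x t hx => by
    have h := P.2.inclIsHom.2 n x t hx
    exact DTree.isOperation_of_antichain (fun i => h.le i)
      (fun l hl htl => (h.leaf ⟨l, trivial⟩ hl htl).exists) fun i j hij => h.antichain hij

end

/-! ### Dendroidal sets, horns and anodyne extensions -/

/-- The category of dendroidal sets. -/
abbrev DSet : Type (u + 1) := DTree.{u}ᵒᵖ ⥤ Type u

/-- The representable dendroidal set `Ω[T]`. -/
abbrev rep (T : DTree.{u}) : DSet.{u} := yoneda.obj T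

/-- For `Q = ∂_f P` an elementary face of the tree `P`, the horn `Λ^f[P] ⊆ Ω[P]`: the union of the
images of all elementary face maps of `P` other than `∂_f`. -/
def horn {R : DTree.{u}} (P Q : Face R) : Subfunctor (rep P.1.toTree) :=
  ⨆ (Q' : Subtree R) (h : IsElementaryFace Q' P.1) (_ : Q' ≠ Q.1),
    Subfunctor.range (yoneda.map (faceMap (Relation.ReflTransGen.single h)))

/-- The horn inclusions `Λ^f[P] → Ω[P]` such that the type of `∂_f` (inner, top or bottom) belongs
to `K`. Here `P` ranges over all faces of all trees, hence over all trees, as each tree is a face of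
itself. -/
inductive hornInclusions (K : Set FaceKind) : MorphismProperty DSet.{u}
  | mk (T : DTree.{u}) (P Q : Face T) (k : FaceKind) (hk : k ∈ K) (h : IsFaceOfKind k Q.1 P.1) :
      hornInclusions K (horn P Q).ι

/-- The smallest class of morphisms which contains `J` and is closed under pushouts, retracts and
transfinite compositions. If `J` consists of normal monomorphisms (as is the case for horn
inclusions), then so does its saturation, because the class of normal monomorphisms is itself
closed under these operations. -/
def saturation (J : MorphismProperty DSet.{u}) : MorphismProperty DSet.{u} := fun _ _ g =>
  ∀ W : MorphismProperty DSet.{u}, J ≤ W → W.IsStableUnderCobaseChange →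
    W.IsStableUnderRetracts → MorphismProperty.IsStableUnderTransfiniteComposition.{u} W → W g

/-- Operadic (inner) anodyne extensions: generated by the inner horn inclusions. -/
def operadicAnodyne : MorphismProperty DSet.{u} := saturation (hornInclusions {FaceKind.inner})

/-- Covariant anodyne extensions: generated by the inner and the top horn inclusions. -/
def covariantAnodyne : MorphismProperty DSet.{u} :=
  saturation (hornInclusions {FaceKind.inner, FaceKind.top})

/-- Stable anodyne extensions: generated by all horn inclusions. -/
def stableAnodyne : MorphismProperty DSet.{u} := saturation (hornInclusions Set.univ)

/-! ### Extension sets -/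

section

variable {R : DTree.{u}}

/-- `P` is a missing face with respect to `A`: the map `Ω[P] → Ω[R]` does not factor through `A`. -/
def IsMissing (A : Subfunctor (rep R)) (P : Face R) : Prop :=
  ¬ Subfunctor.range (yoneda.map P.incl) ≤ A

/-- The elementary faces `P₁` and `P₂` of `P` form a mixed pair `{∂_e, ∂_v}`: `v` is an outer vertex
and `e` is the inner edge attached to it. -/
def IsMixedPair (P₁ P₂ P : Face R) : Prop :=
  ∃ e : R.Edge,
    (IsFaceAt (.inner e) P₁.1 P.1 ∧
      ((∃ w, IsFaceAt (.top e w) P₂.1 P.1) ∨ ∃ r v, IsFaceAt (.bottom r v e) P₂.1 P.1)) ∨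
    (IsFaceAt (.inner e) P₂.1 P.1 ∧
      ((∃ w, IsFaceAt (.top e w) P₁.1 P.1) ∨ ∃ r v, IsFaceAt (.bottom r v e) P₁.1 P.1))

/-- The composable elementary face maps `Q → P₁ → P` form an adjacent pair: they are one of the two
sides of a relation `∂_w ∂_v = ∂_{w ∘_e v} ∂_e` in which `{∂_v, ∂_e}` is a mixed pair of faces of
`P`. -/
def IsAdjacentPair (Q P₁ P : Face R) : Prop :=
  IsElementaryFace Q.1 P₁.1 ∧ IsElementaryFace P₁.1 P.1 ∧
    ∃ P₂ : Face R, IsElementaryFace Q.1 P₂.1 ∧ IsMixedPair P₁ P₂ P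

/-- The extensions `S → P₁` and `S → P₂` of `S` form a bad pair: they are distinct and chop off two
top vertices, or two bottom vertices, attached to the same edge of `S`. -/
def IsBadPair (S P₁ P₂ : Face R) : Prop :=
  P₁ ≠ P₂ ∧
    ((∃ o w₁ w₂, IsFaceAt (.top o w₁) S.1 P₁.1 ∧ IsFaceAt (.top o w₂) S.1 P₂.1) ∨
      ∃ e r₁ v₁ r₂ v₂, IsFaceAt (.bottom r₁ v₁ e) S.1 P₁.1 ∧ IsFaceAt (.bottom r₂ v₂ e) S.1 P₂.1)

/-- `S = P₁ ∪ P₂`: the least face of `R` of which both `P₁` and `P₂` are faces. -/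
def IsUnion (P₁ P₂ S : Face R) : Prop :=
  IsFaceOf P₁.1 S.1 ∧ IsFaceOf P₂.1 S.1 ∧
    ∀ S' : Face R, IsFaceOf P₁.1 S'.1 → IsFaceOf P₂.1 S'.1 → IsFaceOf S.1 S'.1

/-- `F` is an extension set with respect to `A`. An elementary face map `Q → P` between faces of `R`
is determined by its domain and codomain and is written as the pair `(Q, P)`. -/
structure IsExtensionSet (A : Subfunctor (rep R)) (F : Set (Face R × Face R)) : Prop where
  /-- `F` consists of elementary face maps between missing faces. -/
  missing : ∀ Q P, (Q, P) ∈ F → IsElementaryFace Q.1 P.1 ∧ IsMissing A Q ∧ IsMissing A P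
  /-- (F1) Forbidden pairs: no mixed pairs. -/
  no_mixed : ∀ P₁ P₂ P, (P₁, P) ∈ F → (P₂, P) ∈ F → ¬ IsMixedPair P₁ P₂ P
  /-- (F1) Forbidden pairs: no adjacent pairs. -/
  no_adjacent : ∀ Q P₁ P, (Q, P₁) ∈ F → (P₁, P) ∈ F → ¬ IsAdjacentPair Q P₁ P
  /-- (F1) Forbidden pairs: no bad pairs. -/
  no_bad : ∀ S P₁ P₂, (S, P₁) ∈ F → (S, P₂) ∈ F → ¬ IsBadPair S P₁ P₂
  /-- (F1) Forbidden pairs: no two different faces of one corolla. -/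
  no_corolla : ∀ Q₁ Q₂ P : Face R, P.1.IsCorolla → (Q₁, P) ∈ F → (Q₂, P) ∈ F → Q₁ = Q₂
  /-- (F2) The bad pair axiom. -/
  bad_pair : ∀ P P', IsElementaryFace P.1 P'.1 → (P, P') ∉ F →
    ∀ P₁ P₂, (P, P₁) ∈ F → (P, P₂) ∈ F → IsBadPair P P₁ P' → IsBadPair P P₂ P' → P₁ = P₂
  /-- (F3) The face closure axiom. For every commutative square with vertices `P`, `P₁ = ∂_f P`,
  `P₂ = ∂_g P` and `Q = ∂_g ∂_f P = ∂_f ∂_g P`, if a map labelled `∂_f` and a map labelled `∂_g`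
  belong to `F`, then all four maps do. -/
  face_closure : ∀ (f g : FaceIndex R) (P P₁ P₂ Q : Face R),
    IsFaceAt f P₁.1 P.1 → IsFaceAt g P₂.1 P.1 → IsFaceAt g Q.1 P₁.1 → IsFaceAt f Q.1 P₂.1 →
    ((P₁, P) ∈ F ∨ (Q, P₂) ∈ F) → ((P₂, P) ∈ F ∨ (Q, P₁) ∈ F) →
    (P₁, P) ∈ F ∧ (Q, P₂) ∈ F ∧ (P₂, P) ∈ F ∧ (Q, P₁) ∈ F
  /-- (F4) The extension closure axiom. For `P → P'` in `F` and any other extension `P → P''`, every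
  elementary face map `S → S'` that occurs in an extension sequence of `P''` to `P' ∪ P''` belongs
  to `F`. -/
  extension_closure : ∀ P P' P'' U : Face R, (P, P') ∈ F → IsElementaryFace P.1 P''.1 → P' ≠ P'' →
    IsUnion P' P'' U → ∀ S S' : Face R, IsFaceOf P''.1 S.1 → IsElementaryFace S.1 S'.1 →
      IsFaceOf S'.1 U.1 → (S, S') ∈ F
  /-- (F5) The existence axiom. -/
  existence : ∀ P, IsMissing A P → (∃ Q, (Q, P) ∈ F) ∨ ∃ P', (P, P') ∈ F

/-- The inclusion of `A` in `B` is a pushout of the horn inclusion `Λ^f[P] → Ω[P]`, where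
`Q = ∂_f P`, along a map `Λ^f[P] → A` which is the restriction of the face map `Ω[P] → Ω[R]`. -/
def IsPushoutOfHorn (A B : Subfunctor (rep R)) (Q P : Face R) : Prop :=
  ∃ (h : A ≤ B) (a : (horn P Q).toFunctor ⟶ A.toFunctor) (b : rep P.1.toTree ⟶ B.toFunctor),
    IsPushout a (horn P Q).ι (Subfunctor.homOfLe h) b ∧ b ≫ B.ι = yoneda.map P.incl

end

end Dendroidal

namespace Dendroidal

/-! ### Operations and the order of edges -/

namespace DTree

variable {S T : DTree.{u}}

/-! The proof is a discrete Morse matching. A dendroidal subset of `Ω[R]` is determined by the faces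
of `R` that it contains (`mem_iff_not_isMissing`). Adding `Ω[P]` to `B` is a pushout of `Λ^f[P] →
Ω[P]` once `B` contains all elementary faces of `P` other than `∂_f P`, but neither `P` nor `∂_f P`
(`isPushoutOfHorn`); smaller faces take care of themselves, since a proper face of `∂_f P` lies in a
second elementary face (`IsElementaryFace.exists_other`). So the missing faces must be paired as
`(∂_f P, P)` and ordered so that the other faces of `P` are present when `P` is attached.

`F` may offer several partners for one face. The indices are ranked (`FaceIndex.rank`), and each
missing face uses the element of `F` of least rank at it (`Matched`). The crux is
`rank_eq_minRank_iff`: an element `Q → P` of `F` is least at `P` if and only if it is least at `Q`.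
A competitor of smaller rank is carried from one end to the other by a commutative square and (F3);
the configurations without a square are those forbidden by (F1). The remaining competitor, an
extension `Q → P₂`, is carried to the first step from `P` to `P ∪ P₂`, which is in `F` by (F4) and
has no larger rank (`rank_le_of_le_union`). With (F5) and the absence of bad pairs, the matching is
perfect.

Pairs are attached by number of vertices, then by decreasing rank (`attachKey`). Let `S ≠ Q` be
another missing elementary face of `P`. If `S` is the upper member of its pair, it has fewer
vertices than `P`. If it is matched with `P₂`, the same extension argument gives an element of `F`
out of `P` of rank at most that of `S → P₂` and different from that of `Q → P`; so `P₂` has larger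
rank than `P` and comes earlier. -/

/-- An antichain above `t` can be completed by leaves to the inputs of an operation. -/
theorem exists_isOperation (T : DTree.{u}) (t : T.Edge) (X : Set T.Edge) (hX : ∀ x ∈ X, t ≤ x)
    (hanti : ∀ x ∈ X, ∀ y ∈ X, x ≤ y → x = y) :
    ∃ (n : ℕ) (x : Fin n → T.Edge), T.IsOperation x t ∧
      Set.range x = X ∪ {l | l ∈ T.leaves ∧ t ≤ l ∧ ∀ y ∈ X, ¬ y ≤ l} := by
  set Y : Set T.Edge := X ∪ {l | l ∈ T.leaves ∧ t ≤ l ∧ ∀ y ∈ X, ¬ y ≤ l} with hY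
  obtain ⟨n, ⟨e⟩⟩ := Finite.exists_equiv_fin Y
  have hr : Set.range (fun i => ((e.symm i : Y) : T.Edge)) = Y := by
    ext a
    constructor
    · rintro ⟨i, rfl⟩
      exact (e.symm i).2
    · intro ha
      exact ⟨e ⟨a, ha⟩, by simp⟩
  refine ⟨n, fun i => (e.symm i : Y), isOperation_of_antichain ?_ ?_ ?_, hr⟩
  · intro i
    rcases (e.symm i).2 with h | h
    · exact hX _ h
    · exact h.2.1
  · intro l hl htl
    by_cases h : ∃ y ∈ X, y ≤ l
    · obtain ⟨y, hy, hyl⟩ := h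
      have : y ∈ Set.range (fun i => ((e.symm i : Y) : T.Edge)) := by
        rw [hr]; exact Or.inl hy
      obtain ⟨i, hi⟩ := this
      exact ⟨i, hi.le.trans hyl⟩
    · have : l ∈ Set.range (fun i => ((e.symm i : Y) : T.Edge)) := by
        rw [hr]; exact Or.inr ⟨hl, htl, fun y hy hyl => h ⟨y, hy, hyl⟩⟩
      obtain ⟨i, hi⟩ := this
      exact ⟨i, hi.le⟩
  · intro i j hij
    have key : ((e.symm i : Y) : T.Edge) = (e.symm j : Y) := by
      rcases (e.symm i).2 with h | h <;> rcases (e.symm j).2 with h' | h'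
      · exact hanti _ h _ h' hij
      · exact (h'.2.2 _ h hij).elim
      · exact le_antisymm hij (T.leaves_max _ h.1 hij)
      · exact le_antisymm hij (T.leaves_max _ h.1 hij)
    exact e.symm.injective (Subtype.ext key)

theorem Hom.monotone (φ : Hom S T) {a b : S.Edge} (h : a ≤ b) : φ.toFun a ≤ φ.toFun b := by
  obtain ⟨n, x, hx, hr⟩ := S.exists_isOperation a {b} (by simpa using h) (by simp)
  have hb : b ∈ Set.range x := hr ▸ Or.inl rfl
  obtain ⟨i, rfl⟩ := hb
  exact (φ.map_operation n x a hx).le i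

/-- Two incomparable edges are inputs of one operation with output the root. Its image is again an
operation, so its inputs form an antichain and the two images stay incomparable. -/
theorem Hom.comparable (φ : Hom S T) {a b : S.Edge} (h : φ.toFun a ≤ φ.toFun b) :
    a ≤ b ∨ b ≤ a := by
  by_contra hc
  rw [not_or] at hc
  obtain ⟨r, hr⟩ := S.exists_root
  obtain ⟨n, x, hx, hrange⟩ := S.exists_isOperation r {a, b} (fun y _ => hr y) (by
    rintro x (rfl | rfl) y (rfl | rfl) hxy
    · rfl
    · exact (hc.1 hxy).elim
    · exact (hc.2 hxy).elim
    · rfl)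
  have ha : a ∈ Set.range x := hrange ▸ Or.inl (Or.inl rfl)
  have hb : b ∈ Set.range x := hrange ▸ Or.inl (Or.inr rfl)
  obtain ⟨i, rfl⟩ := ha
  obtain ⟨j, rfl⟩ := hb
  have : i = j := (φ.map_operation n x r hx).antichain h
  exact hc.1 (this ▸ le_rfl)

/-- The empty antichain gives the operation from all leaves above `t` to `t`; its image must have an
input below `l`. -/
theorem Hom.exists_leaf (φ : Hom S T) (t : S.Edge) {l : T.Edge} (hl : l ∈ T.leaves)
    (h : φ.toFun t ≤ l) : ∃ m ∈ S.leaves, t ≤ m ∧ φ.toFun m ≤ l := by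
  obtain ⟨n, x, hx, hr⟩ := S.exists_isOperation t ∅ (by simp) (by simp)
  obtain ⟨i, hi, -⟩ := (φ.map_operation n x t hx).leaf l hl h
  have hm : x i ∈ Set.range x := ⟨i, rfl⟩
  rw [hr] at hm
  rcases hm with hm | hm
  · exact hm.elim
  · exact ⟨x i, hm.1, hm.2.1, hi⟩

end DTree

/-! ### The order of subtrees -/

namespace Subtree

variable {R : DTree.{u}}

/-- `Q` is contained in `P` as a tree: below every leaf of `P` and above any edge of `Q` that is
smaller than it there is a leaf of `Q`. -/
structure Le (Q P : Subtree R) : Prop where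
  edges : Q.edges ⊆ P.edges
  leaf : ∀ t ∈ Q.edges, ∀ l ∈ P.leaves, t ≤ l → ∃ l' ∈ Q.leaves, t ≤ l' ∧ l' ≤ l

theorem Le.refl (P : Subtree R) : P.Le P := ⟨subset_rfl, fun _ _ l hl h => ⟨l, hl, h, le_rfl⟩⟩

theorem Le.trans {S Q P : Subtree R} (h : S.Le Q) (h' : Q.Le P) : S.Le P := by
  refine ⟨h.edges.trans h'.edges, fun t ht l hl htl => ?_⟩
  obtain ⟨m, hm, htm, hml⟩ := h'.leaf t (h.edges ht) l hl htl
  obtain ⟨k, hk, htk, hkm⟩ := h.leaf t ht m hm htm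
  exact ⟨k, hk, htk, hkm.trans hml⟩

/-- An edge of `Q` which is a leaf of a larger subtree is a leaf of `Q`. -/
theorem Le.mem_leaves {Q P : Subtree R} (h : Q.Le P) {l : R.Edge} (hl : l ∈ P.leaves)
    (hq : l ∈ Q.edges) : l ∈ Q.leaves := by
  obtain ⟨m, hm, h1, h2⟩ := h.leaf l hq l hl le_rfl
  rwa [le_antisymm h1 h2]

theorem Le.antisymm {Q P : Subtree R} (h : Q.Le P) (h' : P.Le Q) : Q = P := by
  have he := h.edges.antisymm h'.edges
  ext x
  · rw [he]
  · exact ⟨fun hx => h'.mem_leaves hx (h.edges (Q.leaves_subset hx)),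
      fun hx => h.mem_leaves hx (h'.edges (P.leaves_subset hx))⟩

/-- Converse of `inclIsHom_of_leaves`: `Le` is the full combinatorial content of an inclusion of
edges being a map of operads. -/
theorem le_of_inclIsHom {Q P : Subtree R} (h : InclIsHom Q P) : Q.Le P := by
  obtain ⟨h, hop⟩ := h
  refine ⟨h, fun t ht l hl htl => ?_⟩
  obtain ⟨m, hm, h1, h2⟩ := DTree.Hom.exists_leaf
    (DTree.Hom.mk (S := Q.toTree) (T := P.toTree) (fun e => ⟨e.1, h e.2⟩) hop) ⟨t, ht⟩
    (l := ⟨l, P.leaves_subset hl⟩) hl htl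
  exact ⟨m.1, hm, h1, h2⟩

theorem IsRoot.unique {P : Subtree R} {r s : R.Edge} (hr : P.IsRoot r) (hs : P.IsRoot s) :
    r = s := le_antisymm (hr.2 _ hs.1) (hs.2 _ hr.1)

theorem eq_of_leaf_le {P : Subtree R} {l e : R.Edge} (hl : l ∈ P.leaves) (he : e ∈ P.edges)
    (h : l ≤ e) : e = l := by
  by_contra hne
  exact P.leaves_max l hl e he (lt_of_le_of_ne h fun h => hne h.symm)

/-- The immediate successors of `o`. -/
def succ (P : Subtree R) (o : R.Edge) : Set R.Edge :=
  {x ∈ P.edges | o < x ∧ ∀ y ∈ P.edges, ¬ (o < y ∧ y < x)}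

theorem exists_succ_le (P : Subtree R) {o x : R.Edge} (hx : x ∈ P.edges) (h : o < x) :
    ∃ y ∈ P.succ o, y ≤ x := by
  obtain ⟨y, hyx, hy⟩ := (Set.toFinite {z ∈ P.edges | o < z ∧ z ≤ x}).exists_le_minimal
    (a := x) ⟨hx, h, le_rfl⟩
  refine ⟨y, ⟨hy.1.1, hy.1.2.1, fun z hz hoz => ?_⟩, hyx⟩
  exact hoz.2.not_ge (hy.2 ⟨hz, hoz.1, hoz.2.le.trans hyx⟩ hoz.2.le)

theorem succ_antichain {P : Subtree R} {o x y : R.Edge} (hx : x ∈ P.succ o) (hy : y ∈ P.succ o)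
    (h : x ≤ y) : x = y := by
  by_contra hne
  exact hy.2.2 x hx.1 ⟨hx.2.1, lt_of_le_of_ne h hne⟩

theorem succ_eq_of_le {P : Subtree R} {o x y z : R.Edge} (hx : x ∈ P.succ o) (hy : y ∈ P.succ o)
    (hxz : x ≤ z) (hyz : y ≤ z) : x = y :=
  (R.branch z x y hxz hyz).elim (succ_antichain hx hy) fun h => (succ_antichain hy hx h).symm

/-- Number of vertices. -/
noncomputable def deg (P : Subtree R) : ℕ := (P.edges \ P.leaves).ncard

theorem exists_isRoot (P : Subtree R) : ∃ r, P.IsRoot r := P.exists_root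

end Subtree

/-! ### Elementary faces -/

section

variable {R : DTree.{u}} {P Q : Subtree R}

theorem Subtree.IsInner.exists_face {e : R.Edge} (h : P.IsInner e) :
    ∃ Q, IsFaceAt (.inner e) Q P := by
  obtain ⟨r, hr⟩ := P.exists_isRoot
  exact ⟨⟨P.edges \ {e}, P.leaves,
    fun l hl => ⟨P.leaves_subset hl, fun h' => h.2.1 (Set.mem_singleton_iff.1 h' ▸ hl)⟩,
    ⟨r, ⟨hr.1, fun h' => h.2.2 (Set.mem_singleton_iff.1 h' ▸ hr)⟩, fun x hx => hr.2 x hx.1⟩,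
    fun l hl x hx => P.leaves_max l hl x hx.1⟩, h, rfl, rfl⟩

theorem Subtree.exists_top_face {o : R.Edge} (ho : o ∈ P.edges) (ho' : o ∉ P.leaves)
    (hw : P.succ o ⊆ P.leaves) : ∃ Q, IsFaceAt (.top o (P.succ o)) Q P := by
  obtain ⟨r, hr⟩ := P.exists_isRoot
  have hoo : o ∉ P.succ o := fun h => lt_irrefl _ h.2.1
  refine ⟨⟨P.edges \ P.succ o, (P.leaves \ P.succ o) ∪ {o}, ?_, ?_, ?_⟩,
    ⟨ho, ho', rfl⟩, hw, rfl, rfl⟩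
  · rintro l (hl | rfl)
    · exact ⟨P.leaves_subset hl.1, hl.2⟩
    · exact ⟨ho, hoo⟩
  · refine ⟨r, ⟨hr.1, fun h => ?_⟩, fun x hx => hr.2 x hx.1⟩
    exact (hr.2 o ho).not_gt h.2.1
  · rintro l (hl | rfl) x hx hlx
    · exact P.leaves_max l hl.1 x hx.1 hlx
    · obtain ⟨y, hy, hyx⟩ := P.exists_succ_le hx.1 hlx
      rcases eq_or_lt_of_le hyx with h | h
      · exact hx.2 (h ▸ hy)
      · exact P.leaves_max y (hw hy) x hx.1 h

theorem Subtree.exists_bottom_face {r e : R.Edge} (hr : P.IsRoot r) (hr' : r ∉ P.leaves)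
    (he : e ∈ P.succ r) (hv : ∀ x ∈ P.succ r, x ≠ e → x ∈ P.leaves) :
    ∃ Q, IsFaceAt (.bottom r (P.succ r) e) Q P := by
  refine ⟨⟨{t ∈ P.edges | e ≤ t}, P.leaves \ (P.succ r \ {e}), ?_, ?_, ?_⟩,
    hr, ⟨hr.1, hr', rfl⟩, he, hv, rfl, rfl⟩
  · rintro l ⟨hl, hle⟩
    refine ⟨P.leaves_subset hl, ?_⟩
    have hlr : r < l := lt_of_le_of_ne (hr.2 l (P.leaves_subset hl)) fun h => hr' (h ▸ hl)
    obtain ⟨y, hy, hyl⟩ := P.exists_succ_le (P.leaves_subset hl) hlr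
    by_cases hye : y = e
    · exact hye ▸ hyl
    · have := Subtree.eq_of_leaf_le (hv y hy hye) (P.leaves_subset hl) hyl
      exact (hle ⟨this ▸ hy, this ▸ hye⟩).elim
  · exact ⟨e, ⟨he.1, le_rfl⟩, fun x hx => hx.2⟩
  · exact fun l hl x hx => P.leaves_max l hl.1 x hx.1

theorem IsFaceAt.unique {f : FaceIndex R} {Q' : Subtree R} (h : IsFaceAt f Q P)
    (h' : IsFaceAt f Q' P) : Q = Q' := by
  cases f with
  | inner e => exact Subtree.ext (h.2.1.trans h'.2.1.symm) (h.2.2.trans h'.2.2.symm)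
  | top o w => exact Subtree.ext (h.2.2.1.trans h'.2.2.1.symm) (h.2.2.2.trans h'.2.2.2.symm)
  | bottom r v e =>
    exact Subtree.ext (h.2.2.2.2.1.trans h'.2.2.2.2.1.symm)
      (h.2.2.2.2.2.trans h'.2.2.2.2.2.symm)

theorem IsElementaryFace.isFaceOf (h : IsElementaryFace Q P) : IsFaceOf Q P :=
  Relation.ReflTransGen.single h

theorem IsFaceOf.le (h : IsFaceOf Q P) : Q.Le P := Subtree.le_of_inclIsHom h.inclIsHom

theorem IsElementaryFace.le (h : IsElementaryFace Q P) : Q.Le P := h.isFaceOf.le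

/-- Each elementary face loses one vertex, recorded by its output: the contracted edge, the output
of the top vertex, or the old root. -/
theorem IsElementaryFace.deg_eq (h : IsElementaryFace Q P) : P.deg = Q.deg + 1 := by
  obtain ⟨f, hf⟩ := h
  suffices h : ∃ a, a ∈ P.edges ∧ a ∉ P.leaves ∧ Q.edges \ Q.leaves = (P.edges \ P.leaves) \ {a} by
    obtain ⟨a, ha, ha', h⟩ := h
    rw [Subtree.deg, Subtree.deg, h]
    exact (Set.ncard_sdiff_singleton_add_one (s := P.edges \ P.leaves) (a := a) ⟨ha, ha'⟩ (Set.toFinite _)).symm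
  cases f with
  | inner e =>
    obtain ⟨hi, he, hl⟩ := hf
    refine ⟨e, hi.1, hi.2.1, ?_⟩
    rw [he, hl, Set.sdiff_sdiff_comm]
  | top o w =>
    obtain ⟨⟨ho, ho', rfl⟩, hw, he, hl⟩ := hf
    refine ⟨o, ho, ho', ?_⟩
    rw [he, hl]
    ext x
    simp only [Set.mem_sdiff, Set.mem_union, Set.mem_singleton_iff]
    constructor
    · grind
    · rintro ⟨⟨h1, h2⟩, h3⟩
      have : x ∉ P.succ o := fun h => h2 (hw h)
      grind
  | bottom r v e =>
    obtain ⟨hr, ⟨-, hr', rfl⟩, he, hv, hE, hL⟩ := hf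
    refine ⟨r, hr.1, hr', ?_⟩
    rw [hE, hL]
    ext x
    simp only [Set.mem_sdiff, Set.mem_ofPred_eq, Set.mem_singleton_iff]
    constructor
    · rintro ⟨⟨h1, h2⟩, h3⟩
      refine ⟨⟨h1, fun hx => h3 ⟨hx, fun hx' => hx'.2 ?_⟩⟩, fun h => ?_⟩
      · exact (Subtree.succ_antichain he hx'.1 h2).symm
      · exact (h ▸ h2).not_gt he.2.1
    · rintro ⟨⟨h1, h2⟩, h3⟩
      refine ⟨⟨h1, ?_⟩, fun h => h2 h.1⟩
      obtain ⟨y, hy, hyx⟩ := P.exists_succ_le h1 (lt_of_le_of_ne (hr.2 x h1) fun h => h3 h.symm)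
      by_cases hye : y = e
      · exact hye ▸ hyx
      · exact (h2 ((Subtree.eq_of_leaf_le (hv y hy hye) h1 hyx) ▸ hv y hy hye)).elim

/-- A proper subtree is contained in an elementary face. -/
theorem Subtree.Le.exists_elementary (h : Q.Le P) (hne : Q ≠ P) :
    ∃ P', IsElementaryFace P' P ∧ Q.Le P' := by
  obtain ⟨r, hr⟩ := P.exists_isRoot
  obtain ⟨q, hq⟩ := Q.exists_isRoot
  -- An inner edge of `P` outside `Q` can be contracted. If there is none, a top vertex or the
  -- bottom vertex of `P` can be chopped off, according to whether the root of `P` lies in `Q`.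
  by_cases h1 : ∃ e, P.IsInner e ∧ e ∉ Q.edges
  · obtain ⟨e, he, heQ⟩ := h1
    obtain ⟨P', hP'⟩ := he.exists_face
    refine ⟨P', ⟨_, hP'⟩, ?_, ?_⟩
    · rw [hP'.2.1]
      exact fun x hx => ⟨h.edges hx, fun h' => heQ (Set.mem_singleton_iff.1 h' ▸ hx)⟩
    · rw [hP'.2.2]
      exact h.leaf
  push Not at h1
  by_cases h2 : r ∈ Q.edges
  · have hnl : ∀ x ∈ P.edges, x ∉ P.leaves → x ∈ Q.edges := fun x hx hxl => by
      by_cases hxr : P.IsRoot x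
      · exact hr.unique hxr ▸ h2
      · exact h1 x ⟨hx, hxl, hxr⟩
    -- If all leaves of `Q` were leaves of `P`, the two would agree. A leaf `o` of `Q` that is not a
    -- leaf of `P` carries a top vertex of `P`, because all non-leaves of `P` lie in `Q`.
    have h3 : ∃ o ∈ Q.leaves, o ∉ P.leaves := by
      by_contra hc
      push Not at hc
      refine hne (h.antisymm ⟨fun x hx => ?_, fun t _ l hl htl =>
        ⟨l, hc l hl, htl, le_rfl⟩⟩)
      by_cases hxl : x ∈ P.leaves
      · obtain ⟨m, hm, -, hmx⟩ := h.leaf r h2 x hxl (hr.2 x hx)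
        rw [Subtree.eq_of_leaf_le (hc m hm) hx hmx]
        exact Q.leaves_subset hm
      · exact hnl x hx hxl
    obtain ⟨o, hoQ, hoP⟩ := h3
    have hoE := h.edges (Q.leaves_subset hoQ)
    obtain ⟨P', hP'⟩ := P.exists_top_face hoE hoP (fun x hx => by
      by_contra hxl
      exact Q.leaves_max o hoQ x (hnl x hx.1 hxl) hx.2.1)
    refine ⟨P', ⟨_, hP'⟩, ?_, ?_⟩
    · rw [hP'.2.2.1]
      exact fun x hx => ⟨h.edges hx, fun hxo => Q.leaves_max o hoQ x hx hxo.2.1⟩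
    · rw [hP'.2.2.2]
      rintro t ht l (hl | rfl) htl
      · exact h.leaf t ht l hl.1 htl
      · exact ⟨l, hoQ, htl, le_rfl⟩
  · have hqP := h.edges hq.1
    have hrq : r < q := lt_of_le_of_ne (hr.2 q hqP) fun h => h2 (h ▸ hq.1)
    obtain ⟨e, he, heq⟩ := P.exists_succ_le hqP hrq
    -- Another input of the bottom vertex that is not a leaf would be inner, hence in `Q`, hence
    -- above the root `q` of `Q` and so above `e`.
    obtain ⟨P', hP'⟩ := Subtree.exists_bottom_face hr
      (fun hl => P.leaves_max r hl q hqP hrq) he (fun x hx hxe => by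
        by_contra hxl
        have hxQ := h1 x ⟨hx.1, hxl, fun hxr => (hxr.unique hr ▸ hx.2.1).false⟩
        exact hxe (Subtree.succ_antichain he hx (heq.trans (hq.2 x hxQ))).symm)
    refine ⟨P', ⟨_, hP'⟩, ?_, ?_⟩
    · rw [hP'.2.2.2.2.1]
      exact fun x hx => ⟨h.edges hx, heq.trans (hq.2 x hx)⟩
    · rw [hP'.2.2.2.2.2]
      exact fun t ht l hl htl => h.leaf t ht l hl.1 htl

/-- Descent through `exists_elementary`, with the number of vertices decreasing. With `IsFaceOf.le`
this makes being a face a condition on edges and leaves only. -/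
theorem Subtree.Le.isFaceOf (h : Q.Le P) : IsFaceOf Q P := by
  induction hn : P.deg using Nat.strong_induction_on generalizing P with
  | _ n ih =>
    by_cases hne : Q = P
    · exact hne ▸ Relation.ReflTransGen.refl
    · obtain ⟨P', hP', hQ⟩ := h.exists_elementary hne
      exact (ih P'.deg (by have := hP'.deg_eq; omega) hQ rfl).tail hP'

theorem Subtree.Le.deg_le (h : Q.Le P) : Q.deg ≤ P.deg := by
  have := h.isFaceOf
  clear h
  induction this with
  | refl => exact le_rfl
  | tail _ h ih => have := h.deg_eq; omega

theorem Subtree.Le.eq_of_deg_le (h : Q.Le P) (hd : P.deg ≤ Q.deg) : Q = P := by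
  by_contra hne
  obtain ⟨P', hP', hQ⟩ := h.exists_elementary hne
  have := hP'.deg_eq
  have := hQ.deg_le
  omega

end

/-! ### Images of morphisms -/

section

variable {R S : DTree.{u}}

/-- The image of a morphism. -/
def DTree.Hom.image (φ : S ⟶ R) : Subtree R where
  edges := Set.range φ.toFun
  leaves := φ.toFun '' S.leaves
  leaves_subset := Set.image_subset_range _ _
  exists_root := by
    obtain ⟨r, hr⟩ := S.exists_root
    refine ⟨_, ⟨r, rfl⟩, ?_⟩
    rintro _ ⟨e, rfl⟩
    exact φ.monotone (hr e)
  leaves_max := by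
    rintro _ ⟨l, hl, rfl⟩ _ ⟨e, rfl⟩ h
    rcases φ.comparable h.le with h' | h'
    · exact h.not_ge (φ.monotone (S.leaves_max l hl h'))
    · exact h.not_ge (φ.monotone h')

theorem DTree.Hom.image_le_whole (φ : S ⟶ R) : (φ.image).Le (Subtree.whole R) := by
  refine ⟨Set.subset_univ _, ?_⟩
  rintro _ ⟨t, rfl⟩ l hl htl
  obtain ⟨m, hm, htm, hml⟩ := φ.exists_leaf t hl htl
  exact ⟨_, ⟨m, hm, rfl⟩, φ.monotone htm, hml⟩

/-- The image of a morphism to `R`, as a face of `R`. -/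
def DTree.Hom.imageFace (φ : S ⟶ R) : Face R := ⟨φ.image, φ.image_le_whole.isFaceOf⟩

/-- The corestriction of a morphism to a subtree which contains its image. -/
def DTree.Hom.corestrict (φ : S ⟶ R) {P : Subtree R} (h : (φ.image).Le P) : S ⟶ P.toTree :=
  DTree.Hom.mk (fun e => ⟨φ.toFun e, h.edges ⟨e, rfl⟩⟩) fun n x t hx => by
    have h0 := φ.map_operation n x t hx
    refine DTree.isOperation_of_antichain (fun i => h0.le i) ?_ fun i j hij => h0.antichain hij
    intro l hl htl
    obtain ⟨_, ⟨m, hm, rfl⟩, h1, h2⟩ := h.leaf (φ.toFun t) ⟨t, rfl⟩ l.1 hl htl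
    have htm : t ≤ m := (φ.comparable h1).elim id fun h => S.leaves_max m hm h
    obtain ⟨i, hi, -⟩ := hx.leaf m hm htm
    exact ⟨i, (φ.monotone hi).trans h2⟩

theorem DTree.Hom.corestrict_incl (φ : S ⟶ R) {P : Face R} (h : (φ.image).Le P.1) :
    φ.corestrict h ≫ P.incl = φ := rfl

theorem Face.incl_image (P : Face R) : (P.incl).image = P.1 := by
  refine Subtree.ext ?_ ?_
  · exact Subtype.range_val
  · ext x
    exact ⟨fun ⟨l, hl, h⟩ => h ▸ hl, fun hx => ⟨⟨x, P.1.leaves_subset hx⟩, hx, rfl⟩⟩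

theorem DTree.Hom.image_comp_le (ψ : S ⟶ R) {S' : DTree.{u}} (χ : S' ⟶ S) :
    ((χ ≫ ψ).image).Le ψ.image := by
  refine ⟨?_, ?_⟩
  · rintro _ ⟨e, rfl⟩
    exact ⟨_, rfl⟩
  · rintro _ ⟨t, rfl⟩ _ ⟨l, hl, rfl⟩ h
    have h' : χ.toFun t ≤ l := (ψ.comparable h).elim id fun h => S.leaves_max l hl h
    obtain ⟨m, hm, htm, hml⟩ := χ.exists_leaf t hl h'
    exact ⟨_, ⟨m, hm, rfl⟩, (χ ≫ ψ).monotone htm, ψ.monotone hml⟩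

/-- A morphism factors through a face if and only if its image is contained in it. -/
theorem Face.mem_range_iff (P : Face R) (φ : S ⟶ R) :
    φ ∈ (Subfunctor.range (yoneda.map P.incl)).obj (op S) ↔ (φ.image).Le P.1 := by
  constructor
  · rintro ⟨ψ, rfl⟩
    have := DTree.Hom.image_comp_le P.incl ψ
    rwa [P.incl_image] at this
  · intro h
    exact ⟨φ.corestrict h, φ.corestrict_incl h⟩

/-- A morphism which is onto its image has a section. -/
theorem DTree.Hom.exists_section (φ : S ⟶ R) :
    ∃ s : (φ.image).toTree ⟶ S, s ≫ φ = (φ.imageFace).incl := by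
  -- The fibres of `φ` are chains by `comparable`; choosing the largest edge in each makes the
  -- section monotone.
  have hmax : ∀ e : (φ.image).toTree.Edge, ∃ a : S.Edge, φ.toFun a = e.1 ∧
      ∀ b, φ.toFun b = e.1 → b ≤ a := by
    rintro ⟨_, ⟨b, rfl⟩⟩
    obtain ⟨a, hba, ha⟩ := (Set.toFinite {a | φ.toFun a = φ.toFun b}).exists_le_maximal
      (a := b) rfl
    refine ⟨a, ha.1, fun c hc => ?_⟩
    rcases φ.comparable (hc.trans ha.1.symm).le with h | h
    · exact h
    · exact ha.2 hc h
  choose s hs hs' using hmax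
  have hop : ∀ (n : ℕ) (x : Fin n → (φ.image).toTree.Edge) (t : (φ.image).toTree.Edge),
      (φ.image).toTree.IsOperation x t → S.IsOperation (fun i => s (x i)) (s t) := by
    intro n x t hx
    refine DTree.isOperation_of_antichain (fun i => ?_) ?_ fun i j hij => ?_
    · have h : t.1 ≤ (x i).1 := hx.le i
      rcases φ.comparable (a := s t) (b := s (x i)) (by rwa [hs, hs]) with h' | h'
      · exact h'
      · have h2 := φ.monotone h'
        rw [hs, hs] at h2
        exact hs' (x i) (s t) ((hs t).trans (le_antisymm h h2))
    · intro l hl htl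
      have h := φ.monotone htl
      rw [hs] at h
      obtain ⟨i, hi, -⟩ := hx.leaf ⟨φ.toFun l, l, rfl⟩ ⟨l, hl, rfl⟩ h
      have hi' : (x i).1 ≤ φ.toFun l := hi
      rw [← hs] at hi'
      exact ⟨i, (φ.comparable hi').elim id fun h => S.leaves_max l hl h⟩
    · have h := φ.monotone hij
      rw [hs, hs] at h
      exact hx.antichain h
  exact ⟨DTree.Hom.mk s hop, DTree.Hom.ext (funext hs)⟩

/-! ### Dendroidal subsets and missing faces -/

theorem isMissing_iff {A : Subfunctor (rep R)} {P : Face R} :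
    IsMissing A P ↔ P.incl ∉ A.obj (op P.1.toTree) := by
  refine not_congr ⟨fun h => ?_, fun h => ?_⟩
  · exact h _ ((P.mem_range_iff _).2 (by rw [P.incl_image]; exact Subtree.Le.refl _))
  · rintro U _ ⟨ψ, rfl⟩
    exact A.map (Quiver.Hom.op ψ) h

/-- Every morphism is a split epimorphism onto its image followed by a face map, so a dendroidal
subset contains the morphism exactly when it contains the image. This reduces everything to the
finite poset of faces. -/
theorem mem_iff_not_isMissing {A : Subfunctor (rep R)} (φ : S ⟶ R) :
    φ ∈ A.obj (op S) ↔ ¬ IsMissing A φ.imageFace := by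
  rw [isMissing_iff, not_not]
  constructor
  · intro h
    obtain ⟨s, hs⟩ := φ.exists_section
    rw [← hs]
    exact A.map (Quiver.Hom.op s) h
  · intro h
    exact A.map (Quiver.Hom.op (φ.corestrict (Subtree.Le.refl _))) h

theorem range_le_range {P Q : Face R} (h : Q.1.Le P.1) :
    Subfunctor.range (yoneda.map Q.incl) ≤ Subfunctor.range (yoneda.map P.incl) := by
  intro U φ hφ
  exact (P.mem_range_iff (S := U.unop) φ).2 (((Q.mem_range_iff (S := U.unop) φ).1 hφ).trans h)

theorem IsMissing.mono {A : Subfunctor (rep R)} {P Q : Face R} (h : Q.1.Le P.1)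
    (hQ : IsMissing A Q) : IsMissing A P := fun hP => hQ ((range_le_range h).trans hP)

theorem isMissing_sup_range {A : Subfunctor (rep R)} {P X : Face R} :
    IsMissing (A ⊔ Subfunctor.range (yoneda.map P.incl)) X ↔ IsMissing A X ∧ ¬ X.1.Le P.1 := by
  rw [isMissing_iff, isMissing_iff, Subfunctor.max_obj, Set.mem_union, not_or, P.mem_range_iff,
    X.incl_image]

/-- The whole tree, as a face. -/
def Face.whole (R : DTree.{u}) : Face R := ⟨Subtree.whole R, Relation.ReflTransGen.refl⟩

theorem eq_top_of_not_isMissing {A : Subfunctor (rep R)} (h : ¬ IsMissing A (Face.whole R)) :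
    A = ⊤ := by
  rw [eq_top_iff]
  intro U φ _
  exact (mem_iff_not_isMissing (S := U.unop) φ).2
    fun h' => h (h'.mono (DTree.Hom.image_le_whole φ))

instance : Finite (Subtree R) :=
  Finite.of_injective (fun P : Subtree R => (P.edges, P.leaves)) fun _ _ h =>
    Subtree.ext (congrArg Prod.fst h) (congrArg Prod.snd h)

instance : Finite (Face R) := inferInstanceAs (Finite {_P : Subtree R // _})

/-! ### Attaching a horn -/

theorem Face.incl_injective (P : Face R) {φ ψ : S ⟶ P.1.toTree}
    (h : φ ≫ P.incl = ψ ≫ P.incl) : φ = ψ :=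
  DTree.Hom.ext (funext fun e => Subtype.ext (congrFun (congrArg DTree.Hom.toFun h) e))

theorem mem_horn_iff {P Q : Face R} (φ : S ⟶ P.1.toTree) :
    φ ∈ (horn P Q).obj (op S) ↔
      ∃ Q' : Subtree R, IsElementaryFace Q' P.1 ∧ Q' ≠ Q.1 ∧ ((φ ≫ P.incl).image).Le Q' := by
  simp only [horn, Subfunctor.iSup_obj, Set.mem_iUnion]
  constructor
  · rintro ⟨Q', hQ', hne, ψ, rfl⟩
    refine ⟨Q', hQ', hne, ?_⟩
    exact ((Face.mem_range_iff ⟨Q', hQ'.isFaceOf.trans P.2⟩ _).1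
      ⟨ψ, rfl⟩)
  · rintro ⟨Q', hQ', hne, h⟩
    refine ⟨Q', hQ', hne, (φ ≫ P.incl).corestrict h, P.incl_injective rfl⟩

/-- The hypothesis says that `A` meets `Ω[P]` exactly in the horn. As `Ω[P] → Ω[R]` is injective,
`A` and `Ω[P]` are then glued along the horn in every degree, and pushouts of presheaves are
computed objectwise. -/
theorem isPushoutOfHorn {A : Subfunctor (rep R)} {P Q : Face R}
    (h : ∀ X : Face R, X.1.Le P.1 →
      (¬ IsMissing A X ↔ ∃ Q' : Subtree R, IsElementaryFace Q' P.1 ∧ Q' ≠ Q.1 ∧ X.1.Le Q')) :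
    IsPushoutOfHorn A (A ⊔ Subfunctor.range (yoneda.map P.incl)) Q P := by
  have key : ∀ (S : DTree.{u}) (φ : S ⟶ P.1.toTree),
      φ ∈ (horn P Q).obj (op S) ↔ φ ≫ P.incl ∈ A.obj (op S) := by
    intro S φ
    rw [mem_horn_iff, mem_iff_not_isMissing]
    exact (h (φ ≫ P.incl).imageFace (((P.mem_range_iff _).1 ⟨φ, rfl⟩))).symm
  let a : (horn P Q).toFunctor ⟶ A.toFunctor :=
    Subfunctor.lift ((horn P Q).ι ≫ yoneda.map P.incl) (by
      rintro U _ ⟨⟨φ, hφ⟩, rfl⟩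
      exact (key U.unop φ).1 hφ)
  let b : rep P.1.toTree ⟶ (A ⊔ Subfunctor.range (yoneda.map P.incl)).toFunctor :=
    Subfunctor.lift (yoneda.map P.incl) le_sup_right
  refine ⟨le_sup_left, a, b, ⟨⟨rfl⟩, ⟨Limits.evaluationJointlyReflectsColimits _ fun U => ?_⟩⟩, rfl⟩
  refine (Limits.isColimitMapCoconePushoutCoconeEquiv _ _).symm (IsPushout.isColimit ?_)
  have hmono : Mono ((Subfunctor.homOfLe (le_sup_left :
      A ≤ A ⊔ Subfunctor.range (yoneda.map P.incl))).app U) := inferInstance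
  refine Limits.Types.isPushout_of_isPullback_of_mono' ?_ ?_ ?_
  · rw [Limits.Types.isPullback_iff]
    refine ⟨rfl, fun x y hxy => Subtype.ext hxy.2, fun x φ hx => ?_⟩
    have hx' : x.1 = φ ≫ P.incl := congrArg Subtype.val hx
    refine ⟨⟨φ, (key U.unop φ).2 (hx' ▸ x.2)⟩, Subtype.ext hx'.symm, rfl⟩
  · rw [Set.eq_univ_iff_forall]
    rintro ⟨x, hx | ⟨φ, hφ⟩⟩
    · exact Or.inl ⟨⟨x, hx⟩, rfl⟩
    · exact Or.inr ⟨φ, Subtype.ext hφ⟩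
  · exact fun φ ψ _ _ hφψ => P.incl_injective (congrArg Subtype.val hφψ)

end

/-! ### Dendroidal identities -/

section

variable {R : DTree.{u}} {P Q Q' T : Subtree R}

namespace Subtree

theorem eq_of_mem_succ {x o z : R.Edge} (hx : x ∈ P.edges) (ho : o ∈ P.edges)
    (h : z ∈ P.succ x) (h' : z ∈ P.succ o) : x = o := by
  rcases R.branch z x o h.2.1.le h'.2.1.le with h1 | h1 <;>
    rcases eq_or_lt_of_le h1 with h2 | h2
  · exact h2
  · exact (h.2.2 o ho ⟨h2, h'.2.1⟩).elim
  · exact h2.symm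
  · exact (h'.2.2 x hx ⟨h2, h.2.1⟩).elim

theorem exists_lt_of_not_mem_succ {o x : R.Edge} (hx : x ∈ P.edges) (h : o < x)
    (hn : x ∉ P.succ o) : ∃ y ∈ P.edges, o < y ∧ y < x := by
  by_contra hc
  push Not at hc
  exact hn ⟨hx, h, fun y hy hoy => hc y hy hoy.1 hoy.2⟩

end Subtree

open Subtree

/-! ### Vertices and root of an elementary face -/

theorem IsFaceAt.succ_inner {e o : R.Edge} (h : IsFaceAt (.inner e) Q P) (hn : e ∉ P.succ o) :
    Q.succ o = P.succ o := by
  have hm : ∀ x, x ∈ Q.edges ↔ x ∈ P.edges ∧ x ≠ e := fun x => by rw [h.2.1]; rfl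
  ext x
  constructor
  · rintro ⟨h1, h2, h3⟩
    refine ⟨((hm x).1 h1).1, h2, fun y hy hoy => ?_⟩
    by_cases hye : y = e
    · subst hye
      obtain ⟨z, hz, hoz, hzy⟩ := exists_lt_of_not_mem_succ hy hoy.1 hn
      exact h3 z ((hm z).2 ⟨hz, hzy.ne⟩) ⟨hoz, hzy.trans hoy.2⟩
    · exact h3 y ((hm y).2 ⟨hy, hye⟩) hoy
  · intro hx
    exact ⟨(hm x).2 ⟨hx.1, fun h => hn (h ▸ hx)⟩, hx.2.1, fun y hy => hx.2.2 y ((hm y).1 hy).1⟩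

/-- The inputs of the composite vertex `w ∘_e v`. -/
theorem IsFaceAt.succ_inner' {e o : R.Edge} (h : IsFaceAt (.inner e) Q P) (hn : e ∈ P.succ o) :
    Q.succ o = P.succ o \ {e} ∪ P.succ e := by
  have hm : ∀ x, x ∈ Q.edges ↔ x ∈ P.edges ∧ x ≠ e := fun x => by rw [h.2.1]; rfl
  ext x
  constructor
  · rintro ⟨h1, h2, h3⟩
    by_cases hex : e < x
    · refine Or.inr ⟨((hm x).1 h1).1, hex, fun y hy hey => ?_⟩
      exact h3 y ((hm y).2 ⟨hy, hey.1.ne'⟩) ⟨hn.2.1.trans hey.1, hey.2⟩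
    · refine Or.inl ⟨⟨((hm x).1 h1).1, h2, fun y hy hoy => ?_⟩, ((hm x).1 h1).2⟩
      exact h3 y ((hm y).2 ⟨hy, fun h => hex (h ▸ hoy.2)⟩) hoy
  · rintro (hx | hx)
    · exact ⟨(hm x).2 ⟨hx.1.1, hx.2⟩, hx.1.2.1, fun y hy => hx.1.2.2 y ((hm y).1 hy).1⟩
    · refine ⟨(hm x).2 ⟨hx.1, hx.2.1.ne'⟩, hn.2.1.trans hx.2.1, fun y hy hoy => ?_⟩
      rw [hm] at hy
      rcases R.branch x y e hoy.2.le hx.2.1.le with h1 | h1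
      · exact hn.2.2 y hy.1 ⟨hoy.1, lt_of_le_of_ne h1 hy.2⟩
      · exact hx.2.2 y hy.1 ⟨lt_of_le_of_ne h1 hy.2.symm, hoy.2⟩

theorem IsFaceAt.succ_top {o x : R.Edge} {w : Set R.Edge} (h : IsFaceAt (.top o w) Q P)
    (hx : x ∈ P.edges) (hxo : x ≠ o) : Q.succ x = P.succ x := by
  obtain ⟨⟨ho, -, rfl⟩, hw, hE, -⟩ := h
  have hm : ∀ x, x ∈ Q.edges ↔ x ∈ P.edges ∧ x ∉ P.succ o := fun x => by rw [hE]; rfl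
  ext z
  constructor
  · rintro ⟨h1, h2, h3⟩
    refine ⟨((hm z).1 h1).1, h2, fun y hy hxy => ?_⟩
    exact h3 y ((hm y).2 ⟨hy, fun hyo => P.leaves_max y (hw hyo) z ((hm z).1 h1).1 hxy.2⟩) hxy
  · intro hz
    exact ⟨(hm z).2 ⟨hz.1, fun hzo => hxo (eq_of_mem_succ hx ho hz hzo)⟩, hz.2.1,
      fun y hy => hz.2.2 y ((hm y).1 hy).1⟩

theorem IsFaceAt.succ_bottom {r e x : R.Edge} {v : Set R.Edge} (h : IsFaceAt (.bottom r v e) Q P)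
    (hx : e ≤ x) : Q.succ x = P.succ x := by
  have hm : ∀ x, x ∈ Q.edges ↔ x ∈ P.edges ∧ e ≤ x := fun x => by rw [h.2.2.2.2.1]; rfl
  ext z
  constructor
  · rintro ⟨h1, h2, h3⟩
    exact ⟨((hm z).1 h1).1, h2, fun y hy hxy => h3 y ((hm y).2 ⟨hy, hx.trans hxy.1.le⟩) hxy⟩
  · rintro ⟨h1, h2, h3⟩
    exact ⟨(hm z).2 ⟨h1, hx.trans h2.le⟩, h2, fun y hy => h3 y ((hm y).1 hy).1⟩

theorem IsFaceAt.isRoot_inner {e r : R.Edge} (h : IsFaceAt (.inner e) Q P) :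
    Q.IsRoot r ↔ P.IsRoot r := by
  have key : ∀ r, P.IsRoot r → Q.IsRoot r := fun r hr => by
    refine ⟨?_, fun x hx => hr.2 x (by rw [h.2.1] at hx; exact hx.1)⟩
    rw [h.2.1]
    exact ⟨hr.1, fun h' => h.1.2.2 (Set.mem_singleton_iff.1 h' ▸ hr)⟩
  obtain ⟨s, hs⟩ := P.exists_isRoot
  exact ⟨fun hr => (key s hs).unique hr ▸ hs, key r⟩

theorem IsFaceAt.isRoot_top {o r : R.Edge} {w : Set R.Edge} (h : IsFaceAt (.top o w) Q P) :
    Q.IsRoot r ↔ P.IsRoot r := by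
  obtain ⟨⟨ho, -, rfl⟩, hw, hE, -⟩ := h
  have key : ∀ r, P.IsRoot r → Q.IsRoot r := fun r hr => by
    refine ⟨?_, fun x hx => hr.2 x (by rw [hE] at hx; exact hx.1)⟩
    rw [hE]
    exact ⟨hr.1, fun h' => (hr.2 o ho).not_gt h'.2.1⟩
  obtain ⟨s, hs⟩ := P.exists_isRoot
  exact ⟨fun hr => (key s hs).unique hr ▸ hs, key r⟩

theorem IsFaceAt.isRoot_bottom {r e : R.Edge} {v : Set R.Edge} (h : IsFaceAt (.bottom r v e) Q P) :
    Q.IsRoot e := by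
  obtain ⟨hr, ⟨-, -, rfl⟩, he, hv, hE, -⟩ := h
  refine ⟨?_, fun x hx => by rw [hE] at hx; exact hx.2⟩
  rw [hE]
  exact ⟨he.1, le_rfl⟩

/-- In a tree with a bottom face at `e`, all edges not above `e` except the root are leaves
attached to the root. -/
theorem IsFaceAt.bottom_cases {r e x : R.Edge} {v : Set R.Edge} (h : IsFaceAt (.bottom r v e) Q P)
    (hx : x ∈ P.edges) : x = r ∨ e ≤ x ∨ x ∈ v ∧ x ≠ e ∧ x ∈ P.leaves := by
  obtain ⟨hr, ⟨-, -, rfl⟩, he, hv, hE, -⟩ := h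
  by_cases hxr : x = r
  · exact Or.inl hxr
  obtain ⟨y, hy, hyx⟩ := P.exists_succ_le hx (lt_of_le_of_ne (hr.2 x hx) fun h => hxr h.symm)
  by_cases hye : y = e
  · exact Or.inr (Or.inl (hye ▸ hyx))
  · have := eq_of_leaf_le (hv y hy hye) hx hyx
    subst this
    exact Or.inr (Or.inr ⟨hy, hye, hv x hy hye⟩)

/-! #### Commuting faces -/

theorem IsFaceAt.inner_inner {e e' : R.Edge} (h : IsFaceAt (.inner e) Q P)
    (h' : IsFaceAt (.inner e') Q' P) (hne : e ≠ e') :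
    ∃ T, IsFaceAt (.inner e') T Q ∧ IsFaceAt (.inner e) T Q' := by
  have h1 : Q.IsInner e' := by
    refine ⟨?_, ?_, ?_⟩
    · rw [h.2.1]; exact ⟨h'.1.1, hne.symm⟩
    · rw [h.2.2]; exact h'.1.2.1
    · rw [h.isRoot_inner]; exact h'.1.2.2
  obtain ⟨T, hT⟩ := h1.exists_face
  refine ⟨T, hT, ⟨?_, ?_, ?_⟩, ?_, ?_⟩
  · rw [h'.2.1]; exact ⟨h.1.1, hne⟩
  · rw [h'.2.2]; exact h.1.2.1
  · rw [h'.isRoot_inner]; exact h.1.2.2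
  · rw [hT.2.1, h.2.1, h'.2.1, Set.sdiff_sdiff_comm]
  · rw [hT.2.2, h.2.2, h'.2.2]

theorem IsFaceAt.inner_top {e o : R.Edge} {w : Set R.Edge} (h : IsFaceAt (.inner e) Q P)
    (h' : IsFaceAt (.top o w) Q' P) (hne : e ≠ o) :
    ∃ T, IsFaceAt (.top o w) T Q ∧ IsFaceAt (.inner e) T Q' := by
  have h'' := h'
  obtain ⟨⟨ho, ho', hwe⟩, hw, hE, hL⟩ := h'
  obtain rfl : w = P.succ o := hwe
  have hew : e ∉ P.succ o := fun he => h.1.2.1 (hw he)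
  have hs := h.succ_inner hew
  have h1 : o ∈ Q.edges := by rw [h.2.1]; exact ⟨ho, hne.symm⟩
  have h2 : o ∉ Q.leaves := by rwa [h.2.2]
  obtain ⟨T, hT⟩ := Q.exists_top_face h1 h2 (by rwa [hs, h.2.2])
  rw [hs] at hT
  refine ⟨T, hT, ⟨?_, ?_, ?_⟩, ?_, ?_⟩
  · rw [hE]; exact ⟨h.1.1, hew⟩
  · rw [hL]; rintro (h3 | h3)
    · exact h.1.2.1 h3.1
    · exact hne h3
  · rw [h''.isRoot_top]; exact h.1.2.2
  · rw [hT.2.2.1, hE, h.2.1, Set.sdiff_sdiff_comm]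
  · rw [hT.2.2.2, h.2.2, hL]

theorem IsFaceAt.inner_bottom {e r a : R.Edge} {v : Set R.Edge} (h : IsFaceAt (.inner e) Q P)
    (h' : IsFaceAt (.bottom r v a) Q' P) (hne : e ≠ a) :
    ∃ T, IsFaceAt (.bottom r v a) T Q ∧ IsFaceAt (.inner e) T Q' := by
  have h'' := h'
  obtain ⟨hr, ⟨-, hr', hve⟩, ha, hv, hE, hL⟩ := h'
  obtain rfl : v = P.succ r := hve
  have her : e ∉ P.succ r := fun he => h.1.2.1 (hv e he hne)
  have hs := h.succ_inner her
  have hae : a ≤ e := by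
    rcases h''.bottom_cases h.1.1 with h3 | h3 | h3
    · exact (h.1.2.2 (h3 ▸ hr)).elim
    · exact h3
    · exact (h.1.2.1 h3.2.2).elim
  obtain ⟨T, hT⟩ := Subtree.exists_bottom_face (P := Q) (e := a) (h.isRoot_inner.2 hr)
    (by rwa [h.2.2]) (by rwa [hs]) (by rwa [hs, h.2.2])
  rw [hs] at hT
  refine ⟨T, hT, ⟨?_, ?_, ?_⟩, ?_, ?_⟩
  · rw [hE]; exact ⟨h.1.1, hae⟩
  · rw [hL]; exact fun h3 => h.1.2.1 h3.1
  · exact fun h3 => hne (h3.unique h''.isRoot_bottom)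
  · rw [hT.2.2.2.2.1, hE, h.2.1]
    ext x
    simp only [Set.mem_ofPred_eq, Set.mem_sdiff]
    tauto
  · rw [hT.2.2.2.2.2, h.2.2, hL]

theorem IsFaceAt.top_top {o o' : R.Edge} {w w' : Set R.Edge} (h : IsFaceAt (.top o w) Q P)
    (h' : IsFaceAt (.top o' w') Q' P) (hne : o ≠ o') :
    ∃ T, IsFaceAt (.top o' w') T Q ∧ IsFaceAt (.top o w) T Q' := by
  have hs := h.succ_top h'.1.1 hne.symm
  have hs' := h'.succ_top h.1.1 hne
  obtain ⟨⟨ho, hol, hwe⟩, hw, hE, hL⟩ := h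
  obtain rfl : w = P.succ o := hwe
  obtain ⟨⟨ho', hol', hwe'⟩, hw', hE', hL'⟩ := h'
  obtain rfl : w' = P.succ o' := hwe'
  have hd : ∀ x, x ∈ P.succ o → x ∉ P.succ o' := fun x hx hx' =>
    hne (eq_of_mem_succ ho ho' hx hx')
  have h1 : o ∉ P.succ o' := fun hx => hol (hw' hx)
  have h1' : o' ∉ P.succ o := fun hx => hol' (hw hx)
  obtain ⟨T, hT⟩ := Q.exists_top_face (o := o') (by rw [hE]; exact ⟨ho', h1'⟩)
    (by rw [hL]; rintro (h3 | h3); exacts [hol' h3.1, hne h3.symm])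
    (by rw [hs, hL]; exact fun x hx => Or.inl ⟨hw' hx, fun hx' => hd x hx' hx⟩)
  rw [hs] at hT
  refine ⟨T, hT, ⟨?_, ?_, hs'.symm⟩, ?_, ?_, ?_⟩
  · rw [hE']; exact ⟨ho, h1⟩
  · rw [hL']; rintro (h3 | h3); exacts [hol h3.1, hne h3]
  · rw [hL']; exact fun x hx => Or.inl ⟨hw hx, hd x hx⟩
  · rw [hT.2.2.1, hE, hE', Set.sdiff_sdiff_comm]
  · rw [hT.2.2.2, hL, hL']
    ext x
    simp only [Set.mem_union, Set.mem_sdiff, Set.mem_singleton_iff]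
    grind

theorem IsFaceAt.top_bottom {o r e : R.Edge} {w v : Set R.Edge} (h : IsFaceAt (.top o w) Q P)
    (h' : IsFaceAt (.bottom r v e) Q' P) (hne : o ≠ r) :
    ∃ T, IsFaceAt (.bottom r v e) T Q ∧ IsFaceAt (.top o w) T Q' := by
  have hs := h.succ_top h'.1.1 hne.symm
  have hr0 := (h.isRoot_top (r := r)).2 h'.1
  have heo : e ≤ o := by
    rcases h'.bottom_cases h.1.1 with h3 | h3 | h3
    · exact (hne h3).elim
    · exact h3
    · exact (h.1.2.1 h3.2.2).elim
  have hs' := h'.succ_bottom heo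
  obtain ⟨⟨ho, hol, hwe⟩, hw, hE, hL⟩ := h
  obtain rfl : w = P.succ o := hwe
  obtain ⟨hr, ⟨-, hr', hve⟩, he, hv, hE', hL'⟩ := h'
  obtain rfl : v = P.succ r := hve
  have hd : ∀ x, x ∈ P.succ o → x ∉ P.succ r := fun x hx hx' =>
    hne (eq_of_mem_succ ho hr.1 hx hx')
  have hor : ∀ x, x ∈ P.succ r → x ≠ e → x ≠ o := fun x hx hxe hxo => hol (hxo ▸ hv x hx hxe)
  obtain ⟨T, hT⟩ := Subtree.exists_bottom_face (P := Q) (e := e) hr0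
    (by rw [hL]; rintro (h3 | h3); exacts [hr' h3.1, hne h3.symm]) (by rwa [hs])
    (by
      rw [hs, hL]
      exact fun x hx hxe => Or.inl ⟨hv x hx hxe, fun h3 => hd x h3 hx⟩)
  rw [hs] at hT
  refine ⟨T, hT, ⟨?_, ?_, hs'.symm⟩, ?_, ?_, ?_⟩
  · rw [hE']; exact ⟨ho, heo⟩
  · rw [hL']; exact fun h3 => hol h3.1
  · rw [hL']; exact fun x hx => ⟨hw hx, fun h3 => hd x hx h3.1⟩
  · rw [hT.2.2.2.2.1, hE, hE']
    ext x
    simp only [Set.mem_ofPred_eq, Set.mem_sdiff]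
    tauto
  · rw [hT.2.2.2.2.2, hL, hL']
    ext x
    simp only [Set.mem_union, Set.mem_sdiff, Set.mem_singleton_iff]
    grind

/-- `Q₁` and `Q₂` form a mixed pair of faces of `P`. -/
def Subtree.MixedPair (Q₁ Q₂ P : Subtree R) : Prop :=
  ∃ e : R.Edge,
    (IsFaceAt (.inner e) Q₁ P ∧
      ((∃ w, IsFaceAt (.top e w) Q₂ P) ∨ ∃ r v, IsFaceAt (.bottom r v e) Q₂ P)) ∨
    (IsFaceAt (.inner e) Q₂ P ∧
      ((∃ w, IsFaceAt (.top e w) Q₁ P) ∨ ∃ r v, IsFaceAt (.bottom r v e) Q₁ P))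

theorem Subtree.MixedPair.symm {Q₁ Q₂ P : Subtree R} (h : MixedPair Q₁ Q₂ P) :
    MixedPair Q₂ Q₁ P := by
  obtain ⟨e, h | h⟩ := h
  exacts [⟨e, Or.inr h⟩, ⟨e, Or.inl h⟩]

/-- Corollas are the exception in `exists_square`: there distinct faces may remove the same vertex.
-/
theorem IsFaceAt.isCorolla_of_bottom {r e : R.Edge} {v : Set R.Edge}
    (h : IsFaceAt (.bottom r v e) Q P) (he : e ∈ P.leaves) : P.IsCorolla := by
  refine ⟨r, ⟨h.1.1, h.2.1.2.1⟩, fun o ⟨ho, hol⟩ => ?_⟩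
  rcases h.bottom_cases ho with h1 | h1 | h1
  · exact h1
  · exact (hol (eq_of_leaf_le he ho h1 ▸ he)).elim
  · exact (hol h1.2.2).elim

theorem IsFaceAt.isCorolla_of_top {r : R.Edge} {w : Set R.Edge}
    (h : IsFaceAt (.top r w) Q P) (hr : P.IsRoot r) : P.IsCorolla := by
  obtain ⟨⟨ho, hol, rfl⟩, hw, hE, hL⟩ := h
  refine ⟨r, ⟨ho, hol⟩, fun o ⟨ho', hol'⟩ => ?_⟩
  by_contra hne
  obtain ⟨y, hy, hyo⟩ := P.exists_succ_le ho' (lt_of_le_of_ne (hr.2 o ho') fun h => hne h.symm)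
  exact hol' (eq_of_leaf_le (hw hy) ho' hyo ▸ hw hy)

/-- Two different elementary faces of a tree which do not form a mixed pair commute, unless the tree
is a corolla. -/
theorem IsFaceAt.exists_square {f g : FaceIndex R} (hf : IsFaceAt f Q P) (hg : IsFaceAt g Q' P)
    (hne : Q ≠ Q') (hm : ¬ MixedPair Q Q' P) (hc : ¬ P.IsCorolla) :
    ∃ T, IsFaceAt g T Q ∧ IsFaceAt f T Q' := by
  have swap : (∃ T, IsFaceAt f T Q' ∧ IsFaceAt g T Q) → ∃ T, IsFaceAt g T Q ∧ IsFaceAt f T Q' :=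
    fun ⟨T, h1, h2⟩ => ⟨T, h2, h1⟩
  cases f with
  | inner e =>
    cases g with
    | inner e' => exact hf.inner_inner hg fun h => hne (by subst h; exact hf.unique hg)
    | top o w => exact hf.inner_top hg fun h => hm ⟨e, Or.inl ⟨hf, Or.inl ⟨w, h ▸ hg⟩⟩⟩
    | bottom r v a =>
      exact hf.inner_bottom hg fun h => hm ⟨e, Or.inl ⟨hf, Or.inr ⟨r, v, h ▸ hg⟩⟩⟩
  | top o w =>
    cases g with
    | inner e => exact swap (hg.inner_top hf fun h => hm ⟨e, Or.inr ⟨hg, Or.inl ⟨w, h ▸ hf⟩⟩⟩)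
    | top o' w' =>
      refine hf.top_top hg fun h => hne ?_
      subst h
      have : w = w' := hf.1.2.2.trans hg.1.2.2.symm
      subst this
      exact hf.unique hg
    | bottom r v e => exact hf.top_bottom hg fun h => hc (hf.isCorolla_of_top (h ▸ hg.1))
  | bottom r v a =>
    cases g with
    | inner e =>
      exact swap (hg.inner_bottom hf fun h => hm ⟨e, Or.inr ⟨hg, Or.inr ⟨r, v, h ▸ hf⟩⟩⟩)
    | top o w => exact swap (hg.top_bottom hf fun h => hc (hg.isCorolla_of_top (h ▸ hf.1)))
    | bottom r' v' a' =>
      have h1 : r = r' := hf.1.unique hg.1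
      subst h1
      have h2 : v = v' := hf.2.1.2.2.trans hg.2.1.2.2.symm
      subst h2
      by_cases h3 : a = a'
      · subst h3
        exact (hne (hf.unique hg)).elim
      -- Of two bottom faces with different chosen inputs, each forces the input chosen by the other
      -- to be a leaf.
      · exact (hc (hf.isCorolla_of_bottom (hg.2.2.2.1 a hf.2.2.1 h3))).elim

end

section

variable {R : DTree.{u}} {P Q Q' T : Subtree R}

open Subtree

/-! #### Uniqueness of indices -/

theorem IsFaceAt.bottom_root_notMem {r a : R.Edge} {v : Set R.Edge}
    (h : IsFaceAt (.bottom r v a) Q P) : r ∉ Q.edges := by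
  obtain ⟨-, ⟨-, -, rfl⟩, ha, -, hE, -⟩ := h
  rw [hE]
  exact fun h => h.2.not_gt ha.2.1

theorem IsFaceAt.ne_of_bottom {r a : R.Edge} {v : Set R.Edge}
    (h : IsFaceAt (.bottom r v a) Q P) {s : R.Edge} (hs : Q.IsRoot s) : ¬ P.IsRoot s := fun hs' =>
  h.bottom_root_notMem (h.1.unique hs' ▸ hs.1)

/-- Only a bottom face changes the root, and only a top face creates a leaf that was not one before;
so the type, and then the index, can be read off from `Q` and `P`. -/
theorem IsFaceAt.index_unique {f g : FaceIndex R} (hf : IsFaceAt f Q P) (hg : IsFaceAt g Q P) :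
    f = g := by
  obtain ⟨s, hs⟩ := Q.exists_isRoot
  cases f with
  | inner e =>
    cases g with
    | inner e' =>
      by_contra hne
      have : e ∈ Q.edges := by
        rw [hg.2.1]
        exact ⟨hf.1.1, fun h => hne (congrArg _ (Set.mem_singleton_iff.1 h))⟩
      rw [hf.2.1] at this
      exact this.2 rfl
    | top o w =>
      have : o ∈ Q.leaves := by rw [hg.2.2.2]; exact Or.inr rfl
      rw [hf.2.2] at this
      exact (hg.1.2.1 this).elim
    | bottom r v a => exact (hg.ne_of_bottom hs (hf.isRoot_inner.1 hs)).elim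
  | top o w =>
    have ho : o ∈ Q.leaves := by rw [hf.2.2.2]; exact Or.inr rfl
    cases g with
    | inner e =>
      rw [hg.2.2] at ho
      exact (hf.1.2.1 ho).elim
    | top o' w' =>
      rw [hg.2.2.2] at ho
      rcases ho with ho | ho
      · exact (hf.1.2.1 ho.1).elim
      · obtain rfl : o = o' := ho
        rw [hf.1.2.2.trans hg.1.2.2.symm]
    | bottom r v a => exact (hg.ne_of_bottom hs (hf.isRoot_top.1 hs)).elim
  | bottom r v a =>
    cases g with
    | inner e => exact (hf.ne_of_bottom hs (hg.isRoot_inner.1 hs)).elim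
    | top o w => exact (hf.ne_of_bottom hs (hg.isRoot_top.1 hs)).elim
    | bottom r' v' a' =>
      have h1 := hf.isRoot_bottom.unique hg.isRoot_bottom
      have h2 := hf.1.unique hg.1
      subst h1 h2
      rw [hf.2.1.2.2.trans hg.2.1.2.2.symm]

theorem Subtree.MixedPair.ne (h : MixedPair Q Q' P) : Q ≠ Q' := by
  rintro rfl
  obtain ⟨e, ⟨h1, ⟨w, h2⟩ | ⟨r, v, h2⟩⟩ | ⟨h1, ⟨w, h2⟩ | ⟨r, v, h2⟩⟩⟩ := h <;>
    cases h1.index_unique h2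

/-- A face of index `f` is not in turn a source of a face of index `f`. -/
theorem IsFaceAt.not_twice {f : FaceIndex R} (h : IsFaceAt f Q P) : ¬ IsFaceAt f T Q := by
  intro h'
  cases f with
  | inner e =>
    have := h'.1.1
    rw [h.2.1] at this
    exact this.2 rfl
  | top o w =>
    refine h'.1.2.1 ?_
    rw [h.2.2.2]
    exact Or.inr rfl
  | bottom r v a => exact h.bottom_root_notMem h'.1.1

/-! #### Faces of faces -/

/-- The chopped vertex of `Q` arose by contracting `e`. Its inputs are leaves, so in `P` the
vertices at `e` and at `o` can be chopped off one after the other. -/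
theorem IsFaceAt.inner_of_top {e o : R.Edge} {w : Set R.Edge} (hf : IsFaceAt (.inner e) Q P)
    (hg : IsFaceAt (.top o w) T Q) (he : e ∈ P.succ o) :
    ∃ Q', IsFaceAt (.top e (P.succ e)) Q' P ∧ IsFaceAt (.top o (P.succ o)) T Q' := by
  have hs := hf.succ_inner' he
  obtain ⟨⟨ho, hol, hwe⟩, hw, hE, hL⟩ := hg
  obtain rfl : w = Q.succ o := hwe
  rw [hf.2.1] at ho
  rw [hf.2.2] at hol
  rw [hs, hf.2.2] at hw
  obtain ⟨Q', hQ'⟩ := P.exists_top_face hf.1.1 hf.1.2.1 fun x hx => hw (Or.inr hx)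
  have hne : ∀ x, x ∈ P.succ o → x ∉ P.succ e := fun x hx hx' =>
    he.2.1.ne (eq_of_mem_succ ho.1 hf.1.1 hx hx')
  have hel := hf.1.2.1
  have hs' := hQ'.succ_top ho.1 ho.2
  refine ⟨Q', hQ', ⟨?_, ?_, hs'.symm⟩, ?_, ?_, ?_⟩
  · rw [hQ'.2.2.1]; exact ⟨ho.1, fun h => h.2.1.not_gt he.2.1⟩
  · rw [hQ'.2.2.2]; rintro (h | h); exacts [hol h.1, ho.2 h]
  · rw [hQ'.2.2.2]
    intro x hx
    by_cases hxe : x = e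
    · exact Or.inr hxe
    · exact Or.inl ⟨hw (Or.inl ⟨hx, hxe⟩), hne x hx⟩
  · rw [hE, hs, hf.2.1, hQ'.2.2.1]
    ext x
    simp only [Set.mem_union, Set.mem_sdiff, Set.mem_singleton_iff]
    grind
  · rw [hL, hs, hf.2.2, hQ'.2.2.2]
    ext x
    simp only [Set.mem_union, Set.mem_sdiff, Set.mem_singleton_iff]
    grind

/-- The new root lies above `e`, so both vertices joined by `e` are chopped off from below. -/
theorem IsFaceAt.inner_of_bottom {e r a : R.Edge} {v : Set R.Edge} (hf : IsFaceAt (.inner e) Q P)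
    (hg : IsFaceAt (.bottom r v a) T Q) (he : e ∈ P.succ r) (ha : a ∈ P.succ e) :
    ∃ Q', IsFaceAt (.bottom r (P.succ r) e) Q' P ∧ IsFaceAt (.bottom e (P.succ e) a) T Q' := by
  have hs := hf.succ_inner' he
  obtain ⟨hr, ⟨-, hrl, hve⟩, hav, hv, hE, hL⟩ := hg
  obtain rfl : v = Q.succ r := hve
  rw [hf.isRoot_inner] at hr
  rw [hf.2.2] at hrl
  rw [hs, hf.2.2] at hv
  have hne : ∀ x, x ∈ P.succ r → x ∉ P.succ e := fun x hx hx' =>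
    he.2.1.ne (eq_of_mem_succ hr.1 hf.1.1 hx hx')
  obtain ⟨Q', hQ'⟩ := Subtree.exists_bottom_face hr hrl he fun x hx hxe =>
    hv x (Or.inl ⟨hx, hxe⟩) fun h => hne x hx (h ▸ ha)
  have hel := hf.1.2.1
  have hs' := hQ'.succ_bottom (x := e) le_rfl
  refine ⟨Q', hQ', hQ'.isRoot_bottom, ⟨hQ'.isRoot_bottom.1, ?_, hs'.symm⟩, ha, ?_, ?_, ?_⟩
  · rw [hQ'.2.2.2.2.2]; exact fun h => hel h.1
  · rw [hQ'.2.2.2.2.2]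
    exact fun x hx hxa => ⟨hv x (Or.inr hx) hxa, fun h => hne x h.1 hx⟩
  · rw [hE, hf.2.1, hQ'.2.2.2.2.1]
    ext x
    simp only [Set.mem_ofPred_eq, Set.mem_sdiff, Set.mem_singleton_iff]
    constructor
    · exact fun h => ⟨⟨h.1.1, ha.2.1.le.trans h.2⟩, h.2⟩
    · exact fun h => ⟨⟨h.1.1, fun h' => (h' ▸ h.2).not_gt ha.2.1⟩, h.2⟩
  · rw [hL, hs, hf.2.2, hQ'.2.2.2.2.2]
    ext x
    simp only [Set.mem_union, Set.mem_sdiff, Set.mem_singleton_iff]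
    grind

/-- The new root `a` is already an input of the root vertex of `P`, so the vertex on `e` has only
leaves as inputs. It is chopped off as a top vertex, which makes `e` a leaf before the bottom vertex
is removed. -/
theorem IsFaceAt.inner_of_bottom' {e r a : R.Edge} {v : Set R.Edge} (hf : IsFaceAt (.inner e) Q P)
    (hg : IsFaceAt (.bottom r v a) T Q) (he : e ∈ P.succ r) (ha : a ∉ P.succ e) :
    ∃ Q', IsFaceAt (.top e (P.succ e)) Q' P ∧ IsFaceAt (.bottom r (P.succ r) a) T Q' := by
  have hs := hf.succ_inner' he
  obtain ⟨hr, ⟨-, hrl, hve⟩, hav, hv, hE, hL⟩ := hg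
  obtain rfl : v = Q.succ r := hve
  rw [hf.isRoot_inner] at hr
  rw [hf.2.2] at hrl
  rw [hs, hf.2.2] at hv
  rw [hs] at hav
  have har : a ∈ P.succ r ∧ a ≠ e := hav.elim id fun h => (ha h).elim
  have hne : ∀ x, x ∈ P.succ r → x ∉ P.succ e := fun x hx hx' =>
    he.2.1.ne (eq_of_mem_succ hr.1 hf.1.1 hx hx')
  obtain ⟨Q', hQ'⟩ := P.exists_top_face hf.1.1 hf.1.2.1 fun x hx => hv x (Or.inr hx)
    fun h => ha (h ▸ hx)
  have hel := hf.1.2.1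
  have hs' := hQ'.succ_top hr.1 he.2.1.ne
  have hr' := hQ'.isRoot_top.2 hr
  have hnle : ¬ a ≤ e := fun h => har.2 (succ_antichain har.1 he h)
  have hnle' : ∀ x, x ∈ P.succ e → ¬ a ≤ x := fun x hx h =>
    har.2 (succ_eq_of_le har.1 he h hx.2.1.le)
  refine ⟨Q', hQ', hr', ⟨hr'.1, ?_, hs'.symm⟩, har.1, ?_, ?_, ?_⟩
  · rw [hQ'.2.2.2]; rintro (h | h); exacts [hrl h.1, he.2.1.ne h]
  · rw [hQ'.2.2.2]
    intro x hx hxa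
    by_cases hxe : x = e
    · exact Or.inr hxe
    · exact Or.inl ⟨hv x (Or.inl ⟨hx, hxe⟩) hxa, hne x hx⟩
  · rw [hE, hf.2.1, hQ'.2.2.1]
    ext x
    simp only [Set.mem_ofPred_eq, Set.mem_sdiff, Set.mem_singleton_iff]
    constructor
    · exact fun h => ⟨⟨h.1.1, fun hx => hnle' x hx h.2⟩, h.2⟩
    · exact fun h => ⟨⟨h.1.1, fun hx => hnle (hx ▸ h.2)⟩, h.2⟩
  · rw [hL, hs, hf.2.2, hQ'.2.2.2]
    ext x
    simp only [Set.mem_union, Set.mem_sdiff, Set.mem_singleton_iff]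
    grind

/-- The opposite reading of the mixed relation: chopping off two vertices joined by `o` is
contracting `o` and chopping off the composite. -/
theorem IsFaceAt.top_of_top {o o' : R.Edge} {w w' : Set R.Edge} (hf : IsFaceAt (.top o w) Q P)
    (hg : IsFaceAt (.top o' w') T Q) (ho : o ∈ P.succ o') :
    ∃ Q' v, IsFaceAt (.inner o) Q' P ∧ IsFaceAt (.top o' v) T Q' := by
  have hs := hf.succ_top (x := o') ((IsElementaryFace.le ⟨_, hf⟩).edges hg.1.1) ho.2.1.ne
  obtain ⟨⟨hoP, hol, hwe⟩, hw, hE, hL⟩ := hf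
  obtain rfl : w = P.succ o := hwe
  obtain ⟨⟨hoP', hol', hwe'⟩, hw', hE', hL'⟩ := hg
  obtain rfl : w' = Q.succ o' := hwe'
  rw [hs, hL] at hw'
  rw [hE] at hoP'
  obtain ⟨Q', hQ'⟩ := Subtree.IsInner.exists_face (P := P) (e := o)
    ⟨hoP, hol, fun h => (h.2 o' hoP'.1).not_gt ho.2.1⟩
  have hs' := hQ'.succ_inner' ho
  have hne : ∀ x, x ∈ P.succ o' → x ∉ P.succ o := fun x hx hx' =>
    ho.2.1.ne (eq_of_mem_succ hoP'.1 hoP hx hx')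
  have hol'' : o' ∉ P.leaves := fun h => hol' (by rw [hL]; exact Or.inl ⟨h, hoP'.2⟩)
  refine ⟨Q', _, hQ', ⟨?_, ?_, hs'.symm⟩, ?_, ?_, ?_⟩
  · rw [hQ'.2.1]; exact ⟨hoP'.1, ho.2.1.ne⟩
  · rwa [hQ'.2.2]
  · rw [hQ'.2.2]
    rintro x (hx | hx)
    · rcases hw' hx.1 with h | h
      · exact h.1
      · exact (hx.2 h).elim
    · exact hw hx
  · rw [hE', hs, hE, hQ'.2.1]
    ext x
    simp only [Set.mem_union, Set.mem_sdiff, Set.mem_singleton_iff]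
    grind
  · rw [hL', hs, hL, hQ'.2.2]
    ext x
    simp only [Set.mem_union, Set.mem_sdiff, Set.mem_singleton_iff]
    grind

theorem IsFaceAt.top_of_bottom {o r a : R.Edge} {w v : Set R.Edge} (hf : IsFaceAt (.top o w) Q P)
    (hg : IsFaceAt (.bottom r v a) T Q) (ho : o ∈ P.succ r) (hoa : o ≠ a) :
    ∃ Q' v', IsFaceAt (.inner o) Q' P ∧ IsFaceAt (.bottom r v' a) T Q' := by
  have hr := hf.isRoot_top.1 hg.1
  have hs := hf.succ_top hr.1 ho.2.1.ne
  obtain ⟨⟨hoP, hol, hwe⟩, hw, hE, hL⟩ := hf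
  obtain rfl : w = P.succ o := hwe
  obtain ⟨-, ⟨hrQ, hrl, hve⟩, hav, hv, hE', hL'⟩ := hg
  obtain rfl : v = Q.succ r := hve
  rw [hs] at hav hv
  rw [hL] at hv
  obtain ⟨Q', hQ'⟩ := Subtree.IsInner.exists_face (P := P) (e := o)
    ⟨hoP, hol, fun h => (h.2 r hr.1).not_gt ho.2.1⟩
  have hs' := hQ'.succ_inner' ho
  have hne : ∀ x, x ∈ P.succ r → x ∉ P.succ o := fun x hx hx' =>
    ho.2.1.ne (eq_of_mem_succ hr.1 hoP hx hx')
  have hrl' : r ∉ P.leaves := fun h => hrl (by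
    rw [hE] at hrQ; rw [hL]; exact Or.inl ⟨h, hrQ.2⟩)
  have hr' := hQ'.isRoot_inner.2 hr
  have hnle : ¬ a ≤ o := fun h => hoa (succ_antichain hav ho h).symm
  have hnle' : ∀ x, x ∈ P.succ o → ¬ a ≤ x := fun x hx h =>
    hoa (succ_eq_of_le hav ho h hx.2.1.le).symm
  refine ⟨Q', _, hQ', hr', ⟨hr'.1, ?_, hs'.symm⟩, Or.inl ⟨hav, hoa.symm⟩, ?_, ?_, ?_⟩
  · rwa [hQ'.2.2]
  · rw [hQ'.2.2]
    rintro x (hx | hx) hxa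
    · rcases hv x hx.1 hxa with h | h
      · exact h.1
      · exact (hx.2 h).elim
    · exact hw hx
  · rw [hE', hE, hQ'.2.1]
    ext x
    simp only [Set.mem_ofPred_eq, Set.mem_sdiff, Set.mem_singleton_iff]
    constructor
    · exact fun h => ⟨⟨h.1.1, fun hx => hnle (hx ▸ h.2)⟩, h.2⟩
    · exact fun h => ⟨⟨h.1.1, fun hx => hnle' x hx h.2⟩, h.2⟩
  · rw [hL', hs, hL, hQ'.2.2]
    ext x
    simp only [Set.mem_union, Set.mem_sdiff, Set.mem_singleton_iff]
    grind

theorem IsFaceAt.bottom_of_bottom {r a b : R.Edge} {v v' : Set R.Edge}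
    (hf : IsFaceAt (.bottom r v a) Q P) (hg : IsFaceAt (.bottom a v' b) T Q) :
    ∃ Q' v'', IsFaceAt (.inner a) Q' P ∧ IsFaceAt (.bottom r v'' b) T Q' := by
  have hs := hf.succ_bottom (x := a) le_rfl
  obtain ⟨hr, ⟨-, hrl, hve⟩, ha, hv, hE, hL⟩ := hf
  obtain rfl : v = P.succ r := hve
  obtain ⟨-, ⟨-, hal, hve'⟩, hb, hv', hE', hL'⟩ := hg
  obtain rfl : v' = Q.succ a := hve'
  rw [hs] at hb hv'
  rw [hL] at hv'
  have hal' : a ∉ P.leaves := fun h => hal (by rw [hL]; exact ⟨h, fun h' => h'.2 rfl⟩)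
  obtain ⟨Q', hQ'⟩ := Subtree.IsInner.exists_face (P := P) (e := a)
    ⟨ha.1, hal', fun h => (h.2 r hr.1).not_gt ha.2.1⟩
  have hs' := hQ'.succ_inner' ha
  have hne : ∀ x, x ∈ P.succ r → x ∉ P.succ a := fun x hx hx' =>
    ha.2.1.ne (eq_of_mem_succ hr.1 ha.1 hx hx')
  have hr' := hQ'.isRoot_inner.2 hr
  refine ⟨Q', _, hQ', hr', ⟨hr'.1, ?_, hs'.symm⟩, Or.inr hb, ?_, ?_, ?_⟩
  · rwa [hQ'.2.2]
  · rw [hQ'.2.2]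
    rintro x (hx | hx) hxb
    · exact hv x hx.1 hx.2
    · exact (hv' x hx hxb).1
  · rw [hE', hE, hQ'.2.1]
    ext x
    simp only [Set.mem_ofPred_eq, Set.mem_sdiff, Set.mem_singleton_iff]
    constructor
    · exact fun h => ⟨⟨h.1.1, fun hx => (hx ▸ h.2).not_gt hb.2.1⟩, h.2⟩
    · exact fun h => ⟨⟨h.1.1, hb.2.1.le.trans h.2⟩, h.2⟩
  · rw [hL', hs, hL, hQ'.2.2]
    ext x
    simp only [Set.mem_union, Set.mem_sdiff, Set.mem_singleton_iff]
    grind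

/-- A face of codimension two is contained in a second elementary face. -/
theorem IsFaceAt.exists_other {f g : FaceIndex R} (hf : IsFaceAt f Q P) (hg : IsFaceAt g T Q) :
    ∃ Q', (IsFaceAt f T Q' ∧ IsFaceAt g Q' P) ∨
      (IsElementaryFace T Q' ∧ IsElementaryFace Q' P ∧ MixedPair Q Q' P) := by
  cases f with
  | inner e =>
    cases g with
    | inner e' =>
      have h : e' ∈ P.edges ∧ e' ≠ e := by
        have := hg.1.1
        rwa [hf.2.1] at this
      obtain ⟨Q', hQ'⟩ := Subtree.IsInner.exists_face (P := P) (e := e')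
        ⟨h.1, hf.2.2 ▸ hg.1.2.1, fun hr => hg.1.2.2 (hf.isRoot_inner.2 hr)⟩
      obtain ⟨T', h1, h2⟩ := hf.inner_inner hQ' h.2.symm
      exact ⟨Q', Or.inl ⟨h1.unique hg ▸ h2, hQ'⟩⟩
    | top o w =>
      by_cases he : e ∈ P.succ o
      · obtain ⟨Q', h1, h2⟩ := hf.inner_of_top hg he
        exact ⟨Q', Or.inr ⟨⟨_, h2⟩, ⟨_, h1⟩, e, Or.inl ⟨hf, Or.inl ⟨_, h1⟩⟩⟩⟩
      · have hs := hf.succ_inner he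
        have ho : o ∈ P.edges ∧ o ≠ e := by
          have := hg.1.1
          rwa [hf.2.1] at this
        obtain rfl : w = P.succ o := hg.1.2.2.trans hs
        obtain ⟨Q', hQ'⟩ := P.exists_top_face ho.1 (hf.2.2 ▸ hg.1.2.1) (hf.2.2 ▸ hg.2.1)
        obtain ⟨T', h1, h2⟩ := hf.inner_top hQ' ho.2.symm
        exact ⟨Q', Or.inl ⟨h1.unique hg ▸ h2, hQ'⟩⟩
    | bottom r v a =>
      by_cases he : e ∈ P.succ r
      · by_cases ha : a ∈ P.succ e
        · obtain ⟨Q', h1, h2⟩ := hf.inner_of_bottom hg he ha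
          exact ⟨Q', Or.inr ⟨⟨_, h2⟩, ⟨_, h1⟩, e, Or.inl ⟨hf, Or.inr ⟨_, _, h1⟩⟩⟩⟩
        · obtain ⟨Q', h1, h2⟩ := hf.inner_of_bottom' hg he ha
          exact ⟨Q', Or.inr ⟨⟨_, h2⟩, ⟨_, h1⟩, e, Or.inl ⟨hf, Or.inl ⟨_, h1⟩⟩⟩⟩
      · have hs := hf.succ_inner he
        obtain rfl : v = P.succ r := hg.2.1.2.2.trans hs
        have ha := hg.2.2.1
        have hea : e ≠ a := fun h => he (h ▸ ha)
        obtain ⟨Q', hQ'⟩ := Subtree.exists_bottom_face (P := P) (hf.isRoot_inner.1 hg.1)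
          (hf.2.2 ▸ hg.2.1.2.1) ha (hf.2.2 ▸ hg.2.2.2.1)
        obtain ⟨T', h1, h2⟩ := hf.inner_bottom hQ' hea
        exact ⟨Q', Or.inl ⟨h1.unique hg ▸ h2, hQ'⟩⟩
  | top o w =>
    have hsub : ∀ x ∈ Q.leaves, x ≠ o → x ∈ P.leaves := fun x hx hxo => by
      rw [hf.2.2.2] at hx
      exact hx.elim And.left fun h => (hxo h).elim
    have hnl : ∀ x ∈ Q.edges, x ∉ Q.leaves → x ∈ P.edges ∧ x ∉ P.leaves ∧ x ≠ o := by
      intro x hx hxl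
      rw [hf.2.2.1] at hx
      rw [hf.2.2.2] at hxl
      exact ⟨hx.1, fun h => hxl (Or.inl ⟨h, hx.2⟩), fun h => hxl (Or.inr h)⟩
    cases g with
    | inner e =>
      obtain ⟨h1, h2, h3⟩ := hnl e hg.1.1 hg.1.2.1
      obtain ⟨Q', hQ'⟩ := Subtree.IsInner.exists_face (P := P) (e := e)
        ⟨h1, h2, fun hr => hg.1.2.2 (hf.isRoot_top.2 hr)⟩
      obtain ⟨T', h4, h5⟩ := hQ'.inner_top hf h3
      exact ⟨Q', Or.inl ⟨h5.unique hg ▸ h4, hQ'⟩⟩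
    | top o' w' =>
      by_cases ho : o ∈ P.succ o'
      · obtain ⟨Q', v, h1, h2⟩ := hf.top_of_top hg ho
        exact ⟨Q', Or.inr ⟨⟨_, h2⟩, ⟨_, h1⟩, o, Or.inr ⟨h1, Or.inl ⟨_, hf⟩⟩⟩⟩
      · obtain ⟨h1, h2, h3⟩ := hnl o' hg.1.1 hg.1.2.1
        have hs := hf.succ_top h1 h3
        obtain rfl : w' = P.succ o' := hg.1.2.2.trans hs
        obtain ⟨Q', hQ'⟩ := P.exists_top_face h1 h2
          fun x hx => hsub x (hg.2.1 hx) fun h => ho (h ▸ hx)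
        obtain ⟨T', h4, h5⟩ := hf.top_top hQ' h3.symm
        exact ⟨Q', Or.inl ⟨h4.unique hg ▸ h5, hQ'⟩⟩
    | bottom r v a =>
      obtain ⟨h1, h2, h3⟩ := hnl r hg.1.1 hg.2.1.2.1
      have hs := hf.succ_top h1 h3
      obtain rfl : v = P.succ r := hg.2.1.2.2.trans hs
      -- In this case `o` becomes a leaf only in `Q`, so `P` itself has no bottom face at `a` and
      -- the mixed relation takes the place of a square.
      by_cases ho : o ∈ P.succ r ∧ o ≠ a
      · obtain ⟨Q', v, h1, h2⟩ := hf.top_of_bottom hg ho.1 ho.2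
        exact ⟨Q', Or.inr ⟨⟨_, h2⟩, ⟨_, h1⟩, o, Or.inr ⟨h1, Or.inl ⟨_, hf⟩⟩⟩⟩
      · obtain ⟨Q', hQ'⟩ := Subtree.exists_bottom_face (P := P) (hf.isRoot_top.1 hg.1) h2 hg.2.2.1
          fun x hx hxa => hsub x (hg.2.2.2.1 x hx hxa) fun h => ho ⟨h ▸ hx, h ▸ hxa⟩
        obtain ⟨T', h4, h5⟩ := hf.top_bottom hQ' h3.symm
        exact ⟨Q', Or.inl ⟨h4.unique hg ▸ h5, hQ'⟩⟩
  | bottom r v a =>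
    obtain rfl : v = P.succ r := hf.2.1.2.2
    have hnl : ∀ x ∈ Q.edges, x ∉ Q.leaves → x ∈ P.edges ∧ x ∉ P.leaves ∧ a ≤ x ∧ r ≠ x := by
      intro x hx hxl
      rw [hf.2.2.2.2.1] at hx
      rw [hf.2.2.2.2.2] at hxl
      refine ⟨hx.1, fun h => hxl ⟨h, fun h' => h'.2 (succ_antichain hf.2.2.1 h'.1 hx.2).symm⟩,
        hx.2, (hf.2.2.1.2.1.trans_le hx.2).ne⟩
    have hsub : Q.leaves ⊆ P.leaves := by rw [hf.2.2.2.2.2]; exact Set.sdiff_subset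
    cases g with
    | inner e =>
      obtain ⟨h1, h2, h3, h4⟩ := hnl e hg.1.1 hg.1.2.1
      have hea : e ≠ a := fun h => hg.1.2.2 (h ▸ hf.isRoot_bottom)
      obtain ⟨Q', hQ'⟩ := Subtree.IsInner.exists_face (P := P) (e := e)
        ⟨h1, h2, fun hr => h4 (hf.1.unique hr)⟩
      obtain ⟨T', h5, h6⟩ := hQ'.inner_bottom hf hea
      exact ⟨Q', Or.inl ⟨h6.unique hg ▸ h5, hQ'⟩⟩
    | top o w =>
      obtain ⟨h1, h2, h3, h4⟩ := hnl o hg.1.1 hg.1.2.1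
      have hs := hf.succ_bottom h3
      obtain rfl : w = P.succ o := hg.1.2.2.trans hs
      obtain ⟨Q', hQ'⟩ := P.exists_top_face h1 h2 (hg.2.1.trans hsub)
      obtain ⟨T', h5, h6⟩ := hQ'.top_bottom hf h4.symm
      exact ⟨Q', Or.inl ⟨h6.unique hg ▸ h5, hQ'⟩⟩
    | bottom a' v' b =>
      obtain rfl : a = a' := hf.isRoot_bottom.unique hg.1
      obtain ⟨Q', v'', h1, h2⟩ := hf.bottom_of_bottom hg
      exact ⟨Q', Or.inr ⟨⟨_, h2⟩, ⟨_, h1⟩, a, Or.inr ⟨h1, Or.inr ⟨_, _, hf⟩⟩⟩⟩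

/-- A proper face of an elementary face of `P` is contained in a second elementary face of `P`. -/
theorem IsElementaryFace.exists_other (h : IsElementaryFace Q P) (hT : T.Le Q) (hne : T ≠ Q) :
    ∃ Q', IsElementaryFace Q' P ∧ Q' ≠ Q ∧ T.Le Q' := by
  obtain ⟨T', ⟨g, hg⟩, hT'⟩ := hT.exists_elementary hne
  obtain ⟨f, hf⟩ := h
  obtain ⟨Q', ⟨h1, h2⟩ | ⟨h1, h2, h3⟩⟩ := hf.exists_other hg
  · refine ⟨Q', ⟨_, h2⟩, ?_, hT'.trans (IsElementaryFace.le ⟨_, h1⟩)⟩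
    rintro rfl
    exact hf.not_twice h1
  · exact ⟨Q', h2, h3.ne.symm, hT'.trans h1.le⟩

end

/-! ### Unions of faces -/

section

variable {R : DTree.{u}} {P Q S : Subtree R}

namespace Subtree

/-- The union of two subtrees with a common edge. -/
def union (P Q : Subtree R) (h : ∃ s, s ∈ P.edges ∧ s ∈ Q.edges) : Subtree R where
  edges := P.edges ∪ Q.edges
  -- A leaf of one tree over which the other continues is dropped; the last two conditions are what
  -- `P` and `Q` need in order to be contained in the union.
  leaves := {l | (l ∈ P.leaves ∨ l ∈ Q.leaves) ∧ (∀ x ∈ P.edges ∪ Q.edges, ¬ l < x) ∧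
    (∀ t ∈ P.edges, t ≤ l → ∃ l' ∈ P.leaves, t ≤ l' ∧ l' ≤ l) ∧
    ∀ t ∈ Q.edges, t ≤ l → ∃ l' ∈ Q.leaves, t ≤ l' ∧ l' ≤ l}
  leaves_subset _ hl := hl.1.imp (fun h => P.leaves_subset h) fun h => Q.leaves_subset h
  exists_root := by
    obtain ⟨s, hsP, hsQ⟩ := h
    obtain ⟨p, hp⟩ := P.exists_isRoot
    obtain ⟨q, hq⟩ := Q.exists_isRoot
    rcases R.branch s p q (hp.2 s hsP) (hq.2 s hsQ) with h | h
    · exact ⟨p, Or.inl hp.1, fun e he => he.elim (hp.2 e) fun he => h.trans (hq.2 e he)⟩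
    · exact ⟨q, Or.inr hq.1, fun e he => he.elim (fun he => h.trans (hp.2 e he)) (hq.2 e)⟩
  leaves_max _ hl := hl.2.1

variable {h : ∃ s, s ∈ P.edges ∧ s ∈ Q.edges}

theorem le_union_left : P.Le (P.union Q h) :=
  ⟨Set.subset_union_left, fun t ht _ hl htl => hl.2.2.1 t ht htl⟩

theorem le_union_right : Q.Le (P.union Q h) :=
  ⟨Set.subset_union_right, fun t ht _ hl htl => hl.2.2.2 t ht htl⟩

theorem union_le {V : Subtree R} (hP : P.Le V) (hQ : Q.Le V) : (P.union Q h).Le V := by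
  refine ⟨Set.union_subset hP.edges hQ.edges, fun t ht l hl htl => ?_⟩
  have h0 : ∃ m, (m ∈ P.leaves ∨ m ∈ Q.leaves) ∧ m ≤ l ∧ t ≤ m := by
    rcases ht with ht | ht
    · obtain ⟨m, hm, h1, h2⟩ := hP.leaf t ht l hl htl
      exact ⟨m, Or.inl hm, h2, h1⟩
    · obtain ⟨m, hm, h1, h2⟩ := hQ.leaf t ht l hl htl
      exact ⟨m, Or.inr hm, h2, h1⟩
  obtain ⟨m₀, hm₀, hm₀l, htm₀⟩ := h0
  -- The largest leaf of `P` or `Q` below `l` turns out to be a leaf of the union.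
  obtain ⟨m, hm₀m, hm, hmax⟩ := (Set.toFinite
    {m | (m ∈ P.leaves ∨ m ∈ Q.leaves) ∧ m ≤ l}).exists_le_maximal (a := m₀) ⟨hm₀, hm₀l⟩
  have hleaf : ∀ X : Subtree R, X.Le V → (∀ x ∈ X.leaves, x ∈ P.leaves ∨ x ∈ Q.leaves) →
      ∀ t ∈ X.edges, t ≤ m → ∃ l' ∈ X.leaves, t ≤ l' ∧ l' ≤ m := by
    intro X hX hXl t ht htm
    obtain ⟨k, hk, h1, h2⟩ := hX.leaf t ht l hl (htm.trans hm.2)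
    exact ⟨k, hk, h1, (R.branch l k m h2 hm.2).elim id fun h => hmax ⟨hXl k hk, h2⟩ h⟩
  have hP' := hleaf P hP fun x hx => Or.inl hx
  have hQ' := hleaf Q hQ fun x hx => Or.inr hx
  obtain ⟨s, hsP, hsQ⟩ := h
  -- If the root of `X` is below `m`, a leaf of `X` below `m` stops `X` from continuing above `m`.
  -- Otherwise `m` is a leaf of `Y` strictly below the root of `X`, hence below the common edge `s`
  -- of `Y`, which is absurd.
  have hnot : ∀ X Y : Subtree R, s ∈ X.edges → s ∈ Y.edges → (m ∈ X.leaves ∨ m ∈ Y.leaves) →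
      (∀ t ∈ X.edges, t ≤ m → ∃ l' ∈ X.leaves, t ≤ l' ∧ l' ≤ m) → ∀ x ∈ X.edges, ¬ m < x := by
    intro X Y hsX hsY hmXY hX x hx hmx
    obtain ⟨r, hr⟩ := X.exists_isRoot
    by_cases hrm : r ≤ m
    · obtain ⟨k, hk, -, hkm⟩ := hX r hr.1 hrm
      exact X.leaves_max k hk x hx (hkm.trans_lt hmx)
    · rcases hmXY with hmX | hmY
      · exact hrm (hr.2 m (X.leaves_subset hmX))
      · have hmr : m < r := ((R.branch x r m (hr.2 x hx) hmx.le).resolve_left hrm).lt_of_ne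
          fun h => hrm h.ge
        exact Y.leaves_max m hmY s hsY (hmr.trans_le (hr.2 s hsX))
  refine ⟨m, ⟨hm.1, ?_, hP', hQ'⟩, htm₀.trans hm₀m, hm.2⟩
  rintro x (hx | hx)
  · exact hnot P Q hsP hsQ hm.1 hP' x hx
  · exact hnot Q P hsQ hsP hm.1.symm hQ' x hx

end Subtree

/-- The union of two faces with a common edge, as a face. -/
def Face.union (P Q : Face R) (h : ∃ s, s ∈ P.1.edges ∧ s ∈ Q.1.edges) : Face R :=
  ⟨P.1.union Q.1 h, (Subtree.union_le P.2.le Q.2.le).isFaceOf⟩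

theorem Face.isUnion_union (P Q : Face R) (h : ∃ s, s ∈ P.1.edges ∧ s ∈ Q.1.edges) :
    IsUnion P Q (P.union Q h) :=
  ⟨(Subtree.le_union_left (h := h)).isFaceOf, (Subtree.le_union_right (h := h)).isFaceOf,
    fun _ h1 h2 => (Subtree.union_le (h := h) h1.le h2.le).isFaceOf⟩

/-! ### The order of the indices -/

/-- The position of an edge in a linear extension of the order of edges. -/
noncomputable def DTree.number (R : DTree.{u}) (e : R.Edge) : ℕ :=
  letI : Fintype (LinearExtension R.Edge) := @Fintype.ofFinite _ R.finite
  ((Fintype.orderIsoFinOfCardEq (LinearExtension R.Edge) rfl).symm (toLinearExtension e) : ℕ)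

theorem DTree.number_injective (R : DTree.{u}) : Function.Injective R.number := by
  let _ : Fintype (LinearExtension R.Edge) := @Fintype.ofFinite _ R.finite
  intro a b h
  exact (Fintype.orderIsoFinOfCardEq (LinearExtension R.Edge) rfl).symm.injective (Fin.ext h)

theorem DTree.number_mono (R : DTree.{u}) : Monotone R.number := by
  let _ : Fintype (LinearExtension R.Edge) := @Fintype.ofFinite _ R.finite
  intro a b h
  exact (Fintype.orderIsoFinOfCardEq (LinearExtension R.Edge) rfl).symm.monotone
    (toLinearExtension.monotone h)

theorem DTree.number_lt (R : DTree.{u}) (e : R.Edge) : R.number e < Nat.card R.Edge := by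
  let _ : Fintype (LinearExtension R.Edge) := @Fintype.ofFinite _ R.finite
  have : Nat.card R.Edge = Fintype.card (LinearExtension R.Edge) :=
    Nat.card_eq_fintype_card (α := LinearExtension R.Edge)
  rw [this]
  exact Fin.is_lt _

/-- Indices are ordered by type (inner before top before bottom); top vertices are ordered from the
leaves to the root and bottom vertices from the root to the leaves. -/
noncomputable def FaceIndex.rank : FaceIndex R → ℕ
  -- With `n` edges, the three types take values in `[0, n)`, `(n, 2n]` and `[2n + 1, 3n + 1)`, so
  -- ranks determine types.
  | .inner e => R.number e
  | .top o _ => 2 * Nat.card R.Edge - R.number o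
  | .bottom _ _ e => 2 * Nat.card R.Edge + 1 + R.number e

theorem FaceIndex.rank_lt (f : FaceIndex R) : f.rank < 3 * Nat.card R.Edge + 1 := by
  cases f with
  | inner e => have := R.number_lt e; simp only [rank]; omega
  | top o w => have := R.number_lt o; simp only [rank]; omega
  | bottom r v e => have := R.number_lt e; simp only [rank]; omega

theorem FaceIndex.rank_eq {f g : FaceIndex R} (h : f.rank = g.rank) :
    (∃ e, f = .inner e ∧ g = .inner e) ∨ (∃ o w w', f = .top o w ∧ g = .top o w') ∨
      ∃ e r v r' v', f = .bottom r v e ∧ g = .bottom r' v' e := by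
  cases f with
  | inner e =>
    have := R.number_lt e
    cases g with
    | inner e' => exact Or.inl ⟨e, rfl, by rw [R.number_injective h]⟩
    | top o w => have := R.number_lt o; simp only [rank] at h; omega
    | bottom r v a => simp only [rank] at h; omega
  | top o w =>
    have := R.number_lt o
    cases g with
    | inner e => have := R.number_lt e; simp only [rank] at h; omega
    | top o' w' =>
      have := R.number_lt o'
      refine Or.inr (Or.inl ⟨o, w, w', rfl, ?_⟩)
      simp only [rank] at h
      rw [R.number_injective (show R.number o = R.number o' by omega)]
    | bottom r v a => simp only [rank] at h; omega
  | bottom r v a =>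
    cases g with
    | inner e => have := R.number_lt e; simp only [rank] at h; omega
    | top o w => simp only [rank] at h; omega
    | bottom r' v' a' =>
      refine Or.inr (Or.inr ⟨a, r, v, r', v', rfl, ?_⟩)
      simp only [rank] at h
      rw [R.number_injective (show R.number a = R.number a' by omega)]

/-- Two faces of the same rank of one tree have the same index. -/
theorem IsFaceAt.eq_of_rank_eq {Q' : Subtree R} {f g : FaceIndex R} (hf : IsFaceAt f Q P)
    (hg : IsFaceAt g Q' P) (h : f.rank = g.rank) : f = g := by
  obtain ⟨e, rfl, rfl⟩ | ⟨o, w, w', rfl, rfl⟩ | ⟨e, r, v, r', v', rfl, rfl⟩ :=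
    FaceIndex.rank_eq h
  · rfl
  · rw [hf.1.2.2.trans hg.1.2.2.symm]
  · obtain rfl := hf.1.unique hg.1
    rw [hf.2.1.2.2.trans hg.2.1.2.2.symm]

/-- The index of a face of a tree and the index of an extension of it have different ranks. -/
theorem IsFaceAt.rank_ne {f g : FaceIndex R} (hf : IsFaceAt f Q P)
    (hg : IsFaceAt g S Q) : f.rank ≠ g.rank := by
  intro h
  obtain ⟨e, rfl, rfl⟩ | ⟨o, w, w', rfl, rfl⟩ | ⟨e, r, v, r', v', rfl, rfl⟩ :=
    FaceIndex.rank_eq h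
  · exact hf.not_twice hg
  · refine hg.1.2.1 ?_
    rw [hf.2.2.2]
    exact Or.inr rfl
  · have := hf.isRoot_bottom.unique hg.1
    subst this
    have h1 := hg.2.2.1
    rw [hg.2.1.2.2] at h1
    exact lt_irrefl _ h1.2.1

/-- Distinct extensions of the same rank form a bad pair. -/
theorem isBadPair_of_rank_eq {S P₁ P₂ : Face R} {f g : FaceIndex R} (hf : IsFaceAt f S.1 P₁.1)
    (hg : IsFaceAt g S.1 P₂.1) (h : f.rank = g.rank) (hne : P₁ ≠ P₂) : IsBadPair S P₁ P₂ := by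
  refine ⟨hne, ?_⟩
  obtain ⟨e, rfl, rfl⟩ | ⟨o, w, w', rfl, rfl⟩ | ⟨e, r, v, r', v', rfl, rfl⟩ :=
    FaceIndex.rank_eq h
  · have key : ∀ P : Face R, IsFaceAt (.inner e) S.1 P.1 →
        P.1.edges = insert e S.1.edges ∧ P.1.leaves = S.1.leaves := by
      intro P hP
      rw [hP.2.1, Set.insert_sdiff_singleton, Set.insert_eq_of_mem hP.1.1, hP.2.2]
      exact ⟨rfl, rfl⟩
    exact (hne (Subtype.ext (Subtree.ext ((key _ hf).1.trans (key _ hg).1.symm)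
      ((key _ hf).2.trans (key _ hg).2.symm)))).elim
  · exact Or.inl ⟨o, w, w', hf, hg⟩
  · exact Or.inr ⟨e, r, v, r', v', hf, hg⟩

/-- The first step from `P` to the union of `P` and an extension of index `h` of a face of `P` has
at most the rank of `h`. -/
theorem IsFaceAt.rank_le_of_le_union {P₂ P' : Subtree R} {h l : FaceIndex R} (hS : S.Le P)
    (hh : IsFaceAt h S P₂) {hc : ∃ s, s ∈ P.edges ∧ s ∈ P₂.edges} (hl : IsFaceAt l P P')
    (hU : P'.Le (P.union P₂ hc)) : l.rank ≤ h.rank := by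
  obtain ⟨q, hq⟩ := P.exists_isRoot
  obtain ⟨s, hs⟩ := S.exists_isRoot
  have hqs : q ≤ s := hq.2 s (hS.edges hs.1)
  have hnew : ∀ x ∈ P'.edges, x ∉ P.edges → x ∈ P₂.edges ∧ x ∉ S.edges := fun x hx hxP =>
    ⟨(hU.edges hx).resolve_left hxP, fun h => hxP (hS.edges h)⟩
  -- A top step at `x` is impossible if the leaf `x` of `P` is still a leaf of the union.
  have htop : ∀ x w, l = .top x w → (∀ y ∈ P₂.edges, ¬ x < y) →
      (∀ t ∈ P₂.edges, t ≤ x → ∃ l' ∈ P₂.leaves, t ≤ l' ∧ l' ≤ x) → False := by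
    rintro x w rfl h1 h2
    have hxP : x ∈ P.leaves := by rw [hl.2.2.2]; exact Or.inr rfl
    refine hl.1.2.1 (hU.mem_leaves ⟨Or.inl hxP, ?_, fun t _ ht => ⟨x, hxP, ht, le_rfl⟩, h2⟩ hl.1.1)
    rintro y (hy | hy)
    · exact P.leaves_max x hxP y hy
    · exact h1 y hy
  have htopleaf : ∀ x w, l = .top x w → x ∈ P.leaves := by
    rintro x w rfl
    rw [hl.2.2.2]; exact Or.inr rfl
  -- A bottom step adds an edge below the root `q` of `P`, and this edge must come from `P₂`.
  have hbot : ∀ r v e, l = .bottom r v e → e = q ∧ r < q ∧ r ∈ P₂.edges ∧ r ∉ S.edges := by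
    rintro r v e rfl
    obtain rfl := hq.unique hl.isRoot_bottom
    have hlt : r < q := by
      have := hl.2.2.1
      rw [hl.2.1.2.2] at this
      exact this.2.1
    exact ⟨rfl, hlt, hnew r hl.1.1 hl.bottom_root_notMem⟩
  -- These cases dictate the order of the ranks. An inner `h` adds only the edge `y`, so `l` is
  -- inner at `y`. A top `h` adds only edges above `o`, so `l` is inner, or top at some `x ≥ o`. A
  -- bottom `h` allows every type, but a bottom `l` has `q` as its chosen input, which lies below
  -- the root of `S`.
  cases h with
  | inner y =>
    have hP₂ : ∀ x ∈ P₂.edges, x ∉ S.edges → x = y := fun x hx hxS => by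
      by_contra hne
      exact hxS (by rw [hh.2.1]; exact ⟨hx, hne⟩)
    have hsr := hh.isRoot_inner.1 hs
    have hsy : s < y := lt_of_le_of_ne (hsr.2 y hh.1.1) fun h => hh.1.2.2 (h ▸ hsr)
    cases l with
    | inner y' =>
      have h1 := hnew y' hl.1.1 (by rw [hl.2.1]; exact fun h => h.2 rfl)
      rw [hP₂ y' h1.1 h1.2]
    | top x w =>
      exfalso
      have hx := htopleaf x w rfl
      have hSl : ∀ l ∈ S.leaves, l ∈ P₂.leaves := fun l hl => by rwa [hh.2.2] at hl
      refine htop x w rfl (fun z hz hxz => ?_) fun t ht htx => ?_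
      · have hzy : z = y := by
          by_contra hne
          refine P.leaves_max x hx z (hS.edges ?_) hxz
          rw [hh.2.1]
          exact ⟨hz, hne⟩
        subst hzy
        have hsx : s ≤ x := by
          rcases R.branch z s x hsy.le hxz.le with h | h
          · exact h
          · exact (Subtree.eq_of_leaf_le hx (hS.edges hs.1) h).le
        obtain ⟨k, hk, -, hkx⟩ := hS.leaf s hs.1 x hx hsx
        exact P₂.leaves_max k (hSl k hk) z hz (hkx.trans_lt hxz)
      · by_cases htS : t ∈ S.edges
        · obtain ⟨k, hk, h1, h2⟩ := hS.leaf t htS x hx htx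
          exact ⟨k, hSl k hk, h1, h2⟩
        · obtain rfl := hP₂ t ht htS
          obtain ⟨k, hk, -, h2⟩ := hS.leaf s hs.1 x hx (hsy.le.trans htx)
          rcases R.branch x k t h2 htx with h3 | h3
          · have := Subtree.eq_of_leaf_le (hSl k hk) ht h3
            exact ⟨k, hSl k hk, this.le, h2⟩
          · exact ⟨k, hSl k hk, h3, h2⟩
    | bottom r v e =>
      obtain ⟨-, h1, h2, h3⟩ := hbot r v e rfl
      obtain rfl := hP₂ r h2 h3
      exact (hsy.not_ge (h1.le.trans hqs)).elim
  | top o w =>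
    have hoS : o ∈ S.leaves := by rw [hh.2.2.2]; exact Or.inr rfl
    have hoP := hS.edges (S.leaves_subset hoS)
    have hP₂ : ∀ x ∈ P₂.edges, x ∉ S.edges → o < x := fun x hx hxS => by
      have : x ∈ w := by
        by_contra hne
        exact hxS (by rw [hh.2.2.1]; exact ⟨hx, hne⟩)
      rw [hh.1.2.2] at this
      exact this.2.1
    have ho := R.number_lt o
    cases l with
    | inner y => have := R.number_lt y; simp only [FaceIndex.rank]; omega
    | top x w' =>
      suffices hox : o ≤ x by
        have h1 := R.number_mono hox
        have h2 := R.number_lt x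
        simp only [FaceIndex.rank]
        omega
      by_contra hox
      have hx := htopleaf x w' rfl
      refine htop x w' rfl (fun z hz hxz => ?_) fun t ht htx => ?_
      · have hzS : z ∉ S.edges := fun h => P.leaves_max x hx z (hS.edges h) hxz
        rcases R.branch z o x (hP₂ z hz hzS).le hxz.le with h | h
        · exact hox h
        · exact hox (Subtree.eq_of_leaf_le hx hoP h).le
      · by_cases htS : t ∈ S.edges
        · obtain ⟨k, hk, h1, h2⟩ := hS.leaf t htS x hx htx
          rw [hh.2.2.2] at hk
          rcases hk with hk | hk
          · exact ⟨k, hk.1, h1, h2⟩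
          · exact (hox ((Set.mem_singleton_iff.1 hk) ▸ h2)).elim
        · exact (hox ((hP₂ t ht htS).le.trans htx)).elim
    | bottom r v e =>
      obtain ⟨-, h1, h2, h3⟩ := hbot r v e rfl
      exact ((hP₂ r h2 h3).not_ge (h1.le.trans (hq.2 o hoP))).elim
  | bottom r v e =>
    obtain rfl := hs.unique hh.isRoot_bottom
    cases l with
    | inner y => have := R.number_lt y; simp only [FaceIndex.rank]; omega
    | top x w => simp only [FaceIndex.rank]; omega
    | bottom r' v' e' =>
      obtain ⟨rfl, -⟩ := hbot r' v' e' rfl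
      have := R.number_mono hqs
      simp only [FaceIndex.rank]
      omega

end

/-! ### The matching defined by an extension set -/

section

variable {R : DTree.{u}}

/-- `n` is the rank of the index of an element of `F` with domain or codomain `P`. -/
def IsLabel (F : Set (Face R × Face R)) (P : Face R) (n : ℕ) : Prop :=
  ∃ f : FaceIndex R, f.rank = n ∧ ((∃ Q : Face R, (Q, P) ∈ F ∧ IsFaceAt f Q.1 P.1) ∨
    ∃ P' : Face R, (P, P') ∈ F ∧ IsFaceAt f P.1 P'.1)

/-- The least rank of an element of `F` with domain or codomain `P`. -/
noncomputable def minRank (F : Set (Face R × Face R)) (P : Face R) : ℕ := sInf {n | IsLabel F P n}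

/-- `(Q, P)` is an element of `F` of least rank among those with domain or codomain `P`. -/
def Matched (F : Set (Face R × Face R)) (Q P : Face R) : Prop :=
  (Q, P) ∈ F ∧ ∃ f : FaceIndex R, IsFaceAt f Q.1 P.1 ∧ f.rank = minRank F P

variable {F : Set (Face R × Face R)} {P Q S : Face R}

theorem IsLabel.minRank_le {n : ℕ} (h : IsLabel F P n) : minRank F P ≤ n := Nat.sInf_le h

/-- The hypothesis is needed: on a face without labels `minRank` is the default value 0. -/
theorem IsLabel.isLabel_minRank {n : ℕ} (h : IsLabel F P n) : IsLabel F P (minRank F P) :=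
  Nat.sInf_mem (s := {n | IsLabel F P n}) ⟨n, h⟩

/-- An elementary face of a face, as a face. -/
def Face.ofElementary (P : Face R) (Q : Subtree R) (h : IsElementaryFace Q P.1) : Face R :=
  ⟨Q, h.isFaceOf.trans P.2⟩

variable {A : Subfunctor (rep R)}

/-! ### Transport of labels along face maps -/

namespace IsExtensionSet

variable (hF : IsExtensionSet A F)
include hF

/-- The map `P → P'` is the first step from `P` to `P ∪ P₂`, so (F4) and `rank_le_of_le_union`
apply. There is such a step because `P` and `P₂` are distinct with equally many vertices. The map `S
→ P` need not be in `F`; this freedom is used for the order of attachment. -/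
theorem exists_extension {P₂ : Face R} {h : FaceIndex R} (hSP : IsElementaryFace S.1 P.1)
    (hSP₂ : (S, P₂) ∈ F) (hh : IsFaceAt h S.1 P₂.1) (hne : P₂ ≠ P) :
    ∃ (P' : Face R) (l : FaceIndex R), (P, P') ∈ F ∧ IsFaceAt l P.1 P'.1 ∧ l.rank ≤ h.rank := by
  obtain ⟨s, hs⟩ := S.1.exists_isRoot
  have hc : ∃ s, s ∈ P.1.edges ∧ s ∈ P₂.1.edges :=
    ⟨s, hSP.le.edges hs.1, (IsElementaryFace.le ⟨h, hh⟩).edges hs.1⟩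
  have hU := P.isUnion_union P₂ hc
  rcases hU.1.cases_head with h1 | ⟨P', hPP', hP'U⟩
  · have h2 : P₂.1.Le P.1 := by
      have := hU.2.1.le
      rwa [← h1] at this
    refine (hne (Subtype.ext (h2.eq_of_deg_le ?_))).elim
    rw [hSP.deg_eq, IsElementaryFace.deg_eq ⟨h, hh⟩]
  · obtain ⟨l, hl⟩ := hPP'
    refine ⟨⟨P', hP'U.trans (P.union P₂ hc).2⟩, l, ?_, hl, ?_⟩
    · exact hF.extension_closure S P₂ P (P.union P₂ hc) hSP₂ hSP hne
        ⟨hU.2.1, hU.1, fun S' h1 h2 => hU.2.2 S' h2 h1⟩ P _ Relation.ReflTransGen.refl ⟨l, hl⟩ hP'U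
    · exact hh.rank_le_of_le_union (hc := hc) hSP.le hl (IsFaceOf.le hP'U)

/-- A second face of `P` in `F` commutes with `Q`, since (F1) excludes mixed pairs and corollas; an
extension of `P` in `F` commutes with `Q → P`, since (F1) excludes adjacent pairs. In both squares
(F3) gives the same index at `Q`. -/
theorem exists_label_of_codomain {f : FaceIndex R} (hQP : (Q, P) ∈ F) (hf : IsFaceAt f Q.1 P.1)
    {n : ℕ} (hn : IsLabel F P n) (hlt : n < f.rank) : ∃ n' ≤ n, IsLabel F Q n' := by
  obtain ⟨g, rfl, ⟨Q', hQ'P, hg⟩ | ⟨P', hPP', hg⟩⟩ := hn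
  · have hne : Q ≠ Q' := by
      rintro rfl
      exact hlt.ne (by rw [hf.index_unique hg])
    obtain ⟨T, hT, hT'⟩ := hf.exists_square hg (fun h => hne (Subtype.ext h))
      (hF.no_mixed Q Q' P hQP hQ'P) fun hc => hne (hF.no_corolla Q Q' P hc hQP hQ'P)
    have := hF.face_closure f g P Q Q' (Q.ofElementary T ⟨g, hT⟩) hf hg hT hT' (Or.inl hQP)
      (Or.inl hQ'P)
    exact ⟨_, le_rfl, g, rfl, Or.inl ⟨_, this.2.2.2, hT⟩⟩
  · obtain ⟨Q', ⟨h1, h2⟩ | ⟨h1, h2, h3⟩⟩ := hg.exists_other hf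
    · have := hF.face_closure g f P' P (P'.ofElementary Q' ⟨f, h2⟩) Q hg h2 hf h1 (Or.inl hPP')
        (Or.inr hQP)
      exact ⟨_, le_rfl, g, rfl, Or.inr ⟨_, this.2.1, h1⟩⟩
    · exact (hF.no_adjacent Q P P' hQP hPP'
        ⟨⟨f, hf⟩, ⟨g, hg⟩, P'.ofElementary Q' h2, h1, h3⟩).elim

/-- A face of `Q` is moved to `P` by (F3) with its index unchanged. An extension of `Q` is moved by
(F4), which may change the index but does not raise the rank. -/
theorem exists_label_of_domain {f : FaceIndex R} (hQP : (Q, P) ∈ F) (hf : IsFaceAt f Q.1 P.1)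
    {n : ℕ} (hn : IsLabel F Q n) (hlt : n < f.rank) : ∃ n' ≤ n, IsLabel F P n' := by
  obtain ⟨g, rfl, ⟨T, hTQ, hg⟩ | ⟨P', hQP', hg⟩⟩ := hn
  · obtain ⟨Q', ⟨h1, h2⟩ | ⟨h1, h2, h3⟩⟩ := hf.exists_other hg
    · have := hF.face_closure f g P Q (P.ofElementary Q' ⟨g, h2⟩) T hf h2 hg h1 (Or.inl hQP)
        (Or.inr hTQ)
      exact ⟨_, le_rfl, g, rfl, Or.inl ⟨_, this.2.2.1, h2⟩⟩
    · exact (hF.no_adjacent T Q P hTQ hQP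
        ⟨⟨g, hg⟩, ⟨f, hf⟩, P.ofElementary Q' h2, h1, h3⟩).elim
  · have hne : P' ≠ P := by
      rintro rfl
      exact hlt.ne (by rw [hf.index_unique hg])
    obtain ⟨P'', l, h1, h2, h3⟩ := hF.exists_extension ⟨f, hf⟩ hQP' hg hne
    exact ⟨_, h3, l, rfl, Or.inr ⟨P'', h1, h2⟩⟩

theorem rank_eq_minRank_iff {f : FaceIndex R} (hQP : (Q, P) ∈ F) (hf : IsFaceAt f Q.1 P.1) :
    f.rank = minRank F P ↔ f.rank = minRank F Q := by
  have hP : IsLabel F P f.rank := ⟨f, rfl, Or.inl ⟨Q, hQP, hf⟩⟩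
  have hQ : IsLabel F Q f.rank := ⟨f, rfl, Or.inr ⟨P, hQP, hf⟩⟩
  constructor
  · intro h
    by_contra hne
    obtain ⟨n, hn, hl⟩ := hF.exists_label_of_domain hQP hf hQ.isLabel_minRank
      (lt_of_le_of_ne hQ.minRank_le fun h => hne h.symm)
    have h1 := hl.minRank_le
    have h2 := hQ.minRank_le
    omega
  · intro h
    by_contra hne
    obtain ⟨n, hn, hl⟩ := hF.exists_label_of_codomain hQP hf hP.isLabel_minRank
      (lt_of_le_of_ne hP.minRank_le fun h => hne h.symm)
    have h1 := hl.minRank_le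
    have h2 := hP.minRank_le
    omega

theorem exists_matched (hP : IsMissing A P) : (∃ Q, Matched F Q P) ∨ ∃ P', Matched F P P' := by
  have h0 : ∃ n, IsLabel F P n := by
    rcases hF.existence P hP with ⟨Q, hQ⟩ | ⟨P', hP'⟩
    · obtain ⟨f, hf⟩ := (hF.missing _ _ hQ).1
      exact ⟨_, f, rfl, Or.inl ⟨Q, hQ, hf⟩⟩
    · obtain ⟨f, hf⟩ := (hF.missing _ _ hP').1
      exact ⟨_, f, rfl, Or.inr ⟨P', hP', hf⟩⟩
  obtain ⟨n, hn⟩ := h0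
  obtain ⟨f, hf, ⟨Q, hQ, hfQ⟩ | ⟨P', hP', hfP⟩⟩ := hn.isLabel_minRank
  · exact Or.inl ⟨Q, hQ, f, hfQ, hf⟩
  · exact Or.inr ⟨P', hP', f, hfP, (hF.rank_eq_minRank_iff hP' hfP).2 hf⟩

/-- Both extensions have the rank `minRank F Q`, and distinct extensions of equal rank form a bad
pair. -/
theorem matched_unique_codomain {P' : Face R} (h : Matched F Q P) (h' : Matched F Q P') :
    P = P' := by
  obtain ⟨hQP, f, hf, hr⟩ := h
  obtain ⟨hQP', f', hf', hr'⟩ := h'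
  by_contra hne
  refine hF.no_bad Q P P' hQP hQP' (isBadPair_of_rank_eq hf hf' ?_ hne)
  rw [(hF.rank_eq_minRank_iff hQP hf).1 hr, (hF.rank_eq_minRank_iff hQP' hf').1 hr']

/-- Both maps would have the rank `minRank F P`, against `rank_ne`. -/
theorem not_matched_matched {P' : Face R} (h : Matched F Q P) : ¬ Matched F P P' := by
  obtain ⟨hQP, f, hf, hr⟩ := h
  rintro ⟨hPP', f', hf', hr'⟩
  exact hf'.rank_ne hf (((hF.rank_eq_minRank_iff hPP' hf').1 hr').trans hr.symm)

end IsExtensionSet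

theorem Matched.unique_domain {Q' : Face R} (h : Matched F Q P) (h' : Matched F Q' P) :
    Q = Q' := by
  obtain ⟨-, f, hf, hr⟩ := h
  obtain ⟨-, f', hf', hr'⟩ := h'
  obtain rfl := hf.eq_of_rank_eq hf' (hr.trans hr'.symm)
  exact Subtype.ext (hf.unique hf')

theorem Matched.isElementaryFace (h : Matched F Q P) : IsElementaryFace Q.1 P.1 := by
  obtain ⟨-, f, hf, -⟩ := h
  exact ⟨f, hf⟩

theorem Matched.minRank_lt (h : Matched F Q P) : minRank F P < 3 * Nat.card R.Edge + 1 := by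
  obtain ⟨-, f, -, hr⟩ := h
  exact hr ▸ f.rank_lt

/-! ### The order of attachment -/

/-- The pairs of the matching are attached in the order of this number: by the number of vertices,
and then by decreasing rank. -/
noncomputable def attachKey (F : Set (Face R × Face R)) (P : Face R) : ℕ :=
  P.1.deg * (3 * Nat.card R.Edge + 1) + (3 * Nat.card R.Edge + 1 - minRank F P)

/-- The second summand of the key is at most `3n + 1`, the weight of one vertex, and it is positive
for `P`; this makes the inequality strict without a bound on `minRank F S`. -/
theorem attachKey_lt_of_deg_lt (h : S.1.deg < P.1.deg)
    (hP : minRank F P < 3 * Nat.card R.Edge + 1) : attachKey F S < attachKey F P := by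
  have h1 := Nat.mul_le_mul_right (3 * Nat.card R.Edge + 1) (Nat.succ_le_of_lt h)
  rw [Nat.succ_mul] at h1
  unfold attachKey
  omega

theorem attachKey_lt_of_minRank_lt (h : S.1.deg = P.1.deg) (h' : minRank F P < minRank F S)
    (hS : minRank F S < 3 * Nat.card R.Edge + 1) : attachKey F S < attachKey F P := by
  unfold attachKey
  rw [h]
  omega

/-- In either case `S` enters the filtration before `P`: as the upper member of a pair with fewer
vertices, or together with some `P₂` of the same size and larger rank. -/
theorem IsExtensionSet.exists_matched_lt (hF : IsExtensionSet A F) (h : Matched F Q P)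
    (hS : IsElementaryFace S.1 P.1) (hSQ : S ≠ Q) (hm : IsMissing A S) :
    (∃ S', Matched F S' S ∧ attachKey F S < attachKey F P) ∨
      ∃ P₂, Matched F S P₂ ∧ attachKey F P₂ < attachKey F P := by
  rcases hF.exists_matched hm with ⟨S', hS'⟩ | ⟨P₂, hP₂⟩
  · refine Or.inl ⟨S', hS', attachKey_lt_of_deg_lt ?_ h.minRank_lt⟩
    rw [hS.deg_eq]
    exact Nat.lt_succ_self _
  · refine Or.inr ⟨P₂, hP₂, ?_⟩
    have hne : P₂ ≠ P := by
      rintro rfl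
      exact hSQ (hP₂.unique_domain h)
    refine attachKey_lt_of_minRank_lt ?_ ?_ hP₂.minRank_lt
    · rw [hS.deg_eq, hP₂.isElementaryFace.deg_eq]
    · obtain ⟨hSP₂, g, hg, hgr⟩ := hP₂
      -- The rank of `l` is a label at `P` and differs from the minimum there, which is attained by
      -- `f`; hence `minRank F P < l.rank ≤ minRank F P₂`.
      obtain ⟨P', l, h1, h2, h3⟩ := hF.exists_extension hS hSP₂ hg hne
      obtain ⟨hQP, f, hf, hfr⟩ := h
      have h4 : IsLabel F P l.rank := ⟨l, rfl, Or.inr ⟨P', h1, h2⟩⟩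
      have h5 := h4.minRank_le
      have h6 := h2.rank_ne hf
      omega

/-! ### The filtration -/

/-- Induction on the number of faces missing from `B`. The invariant `hB`, that the two members of a
matched pair are both missing or both present, ensures that attaching the upper member fills a horn.
-/
theorem IsExtensionSet.exists_filtration (hF : IsExtensionSet A F) (B : Subfunctor (rep R))
    (hAB : A ≤ B) (hB : ∀ Q P, Matched F Q P → (IsMissing B Q ↔ IsMissing B P)) :
    ∃ (N : ℕ) (C : ℕ → Subfunctor (rep R)), C 0 = B ∧ C N = ⊤ ∧
      ∀ i < N, ∃ Q P : Face R, (Q, P) ∈ F ∧ IsPushoutOfHorn (C i) (C (i + 1)) Q P := by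
  induction hn : {P : Face R | IsMissing B P}.ncard using Nat.strong_induction_on
    generalizing B with
  | _ n ih =>
    by_cases htop : B = ⊤
    · exact ⟨0, fun _ => B, rfl, htop, fun i hi => (Nat.not_lt_zero i hi).elim⟩
    have hmis : ∀ X, IsMissing B X → IsMissing A X := fun X hX h => hX (h.trans hAB)
    have hw : IsMissing B (Face.whole R) := by
      by_contra h
      exact htop (eq_top_of_not_isMissing h)
    have hne : {P | (∃ Q, Matched F Q P) ∧ IsMissing B P}.Nonempty := by
      rcases hF.exists_matched (hmis _ hw) with ⟨Q, hQ⟩ | ⟨P', hP'⟩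
      · exact ⟨_, ⟨Q, hQ⟩, hw⟩
      · exact ⟨P', ⟨_, hP'⟩, (hB _ _ hP').1 hw⟩
    obtain ⟨P, ⟨⟨Q, hQP⟩, hP⟩, hmin⟩ := Set.exists_min_image _ (attachKey F) (Set.toFinite _) hne
    have hQ : IsMissing B Q := (hB Q P hQP).2 hP
    -- If another elementary face were missing, the upper member of its pair would be missing with a
    -- smaller key than `P`.
    have hfaces : ∀ Q' : Subtree R, IsElementaryFace Q' P.1 → Q' ≠ Q.1 →
        ∀ X : Face R, X.1.Le Q' → ¬ IsMissing B X := by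
      intro Q' hQ' hneQ X hX hXB
      set S : Face R := P.ofElementary Q' hQ' with hSdef
      have hS : IsMissing B S := hXB.mono (P := S) hX
      rcases hF.exists_matched_lt hQP (S := S) hQ' (fun h => hneQ (congrArg Subtype.val h))
        (hmis _ hS) with ⟨S', hS', hlt⟩ | ⟨P₂, hP₂, hlt⟩
      · exact (hmin S ⟨⟨S', hS'⟩, hS⟩).not_gt hlt
      · exact (hmin P₂ ⟨⟨S, hP₂⟩, (hB _ _ hP₂).1 hS⟩).not_gt hlt
    -- Thus `P` and `Q` are the only faces of `P` outside the horn.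
    have hother : ∀ X : Face R, X.1.Le P.1 → X ≠ P → X ≠ Q →
        ∃ Q' : Subtree R, IsElementaryFace Q' P.1 ∧ Q' ≠ Q.1 ∧ X.1.Le Q' := by
      intro X hX hXP hXQ
      obtain ⟨Q', hQ', hXQ'⟩ := hX.exists_elementary fun h => hXP (Subtype.ext h)
      by_cases hQQ : Q' = Q.1
      · subst hQQ
        exact hQ'.exists_other hXQ' fun h => hXQ (Subtype.ext h)
      · exact ⟨Q', hQ', hQQ, hXQ'⟩
    set B' : Subfunctor (rep R) := B ⊔ Subfunctor.range (yoneda.map P.incl) with hB'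
    have hpush : IsPushoutOfHorn B B' Q P := by
      refine isPushoutOfHorn fun X hX => ⟨fun hXB => ?_, fun ⟨Q', h1, h2, h3⟩ => hfaces Q' h1 h2 X h3⟩
      exact hother X hX (fun h => hXB (h ▸ hP)) fun h => hXB (h ▸ hQ)
    obtain ⟨N, C, hC0, hCN, hC⟩ := ih {P : Face R | IsMissing B' P}.ncard (by
      rw [← hn]
      refine Set.ncard_lt_ncard ⟨fun X hX => (isMissing_sup_range.1 hX).1, fun h => ?_⟩
        (Set.toFinite _)
      exact (isMissing_sup_range.1 (h hP)).2 (Subtree.Le.refl _)) B' (hAB.trans le_sup_left)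
      (by
        intro Q₂ P₂ h₂
        rw [isMissing_sup_range, isMissing_sup_range, hB Q₂ P₂ h₂]
        -- Only `P` and `Q` cease to be missing. Here `Q₂ = P` is impossible as `P` is already an
        -- upper member, `Q₂ = Q` forces `P₂ = P`, and any other `Q₂` inside `P` was present before.
        refine and_congr_right fun hm => not_congr ⟨fun hle => ?_, fun hle =>
          h₂.isElementaryFace.le.trans hle⟩
        by_cases h1 : Q₂ = P
        · subst h1
          exact (hF.not_matched_matched hQP h₂).elim
        by_cases h2 : Q₂ = Q
        · subst h2
          rw [hF.matched_unique_codomain h₂ hQP]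
          exact Subtree.Le.refl _
        · obtain ⟨Q', h3, h4, h5⟩ := hother Q₂ hle h1 h2
          exact (hfaces Q' h3 h4 Q₂ h5 ((hB Q₂ P₂ h₂).2 hm)).elim) rfl
    refine ⟨N + 1, fun i => Nat.casesOn i B C, rfl, hCN, fun i hi => ?_⟩
    cases i with
    | zero =>
      refine ⟨Q, P, hQP.1, ?_⟩
      change IsPushoutOfHorn B (C 0) Q P
      rwa [hC0]
    | succ i => exact hC i (Nat.lt_of_succ_lt_succ hi)

/-! ### Anodyne extensions -/

/-- The filtration is finite, so isomorphisms, cobase changes and binary composites suffice. -/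
theorem saturation_ι_of_filtration {K : Set FaceKind} (N : ℕ) (C : ℕ → Subfunctor (rep R))
    (hN : C N = ⊤) (hC : ∀ i < N, ∃ (Q P : Face R) (k : FaceKind), k ∈ K ∧
      IsFaceOfKind k Q.1 P.1 ∧ IsPushoutOfHorn (C i) (C (i + 1)) Q P) :
    saturation (hornInclusions K) (C 0).ι := by
  intro W hW hcob _ htrans
  induction N generalizing C with
  | zero =>
    have : IsIso (C 0).ι := (Subfunctor.eq_top_iff_isIso _).1 hN
    exact W.of_isIso _
  | succ N ih =>
    obtain ⟨Q, P, k, hk, hQP, hle, a, b, hpush, -⟩ := hC 0 (Nat.succ_pos N)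
    have h1 : W (Subfunctor.homOfLe hle) :=
      W.of_isPushout hpush (hW _ (hornInclusions.mk R P Q k hk hQP))
    have h2 : W (C 1).ι := ih (fun i => C (i + 1)) hN fun i hi => hC (i + 1) (Nat.succ_lt_succ hi)
    rw [← Subfunctor.homOfLe_ι hle]
    exact W.comp_mem _ _ h1 h2

end

end Dendroidal

/-! ### The theorem on extension sets -/

theorem theorem3 (R : Dendroidal.DTree.{u}) (A : Subfunctor (Dendroidal.rep R))
    (F : Set (Dendroidal.Face R × Dendroidal.Face R)) (hF : Dendroidal.IsExtensionSet A F) :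
    (∃ (N : ℕ) (B : ℕ → Subfunctor (Dendroidal.rep R)), B 0 = A ∧ B N = ⊤ ∧
      ∀ i < N, ∃ Q P : Dendroidal.Face R,
        (Q, P) ∈ F ∧ Dendroidal.IsPushoutOfHorn (B i) (B (i + 1)) Q P) ∧
    Dendroidal.stableAnodyne A.ι ∧
    ((∀ Q P, (Q, P) ∈ F → Dendroidal.IsFaceOfKind .inner Q.1 P.1 ∨
        Dendroidal.IsFaceOfKind .top Q.1 P.1) → Dendroidal.covariantAnodyne A.ι) ∧
    ((∀ Q P, (Q, P) ∈ F → Dendroidal.IsFaceOfKind .inner Q.1 P.1) →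
      Dendroidal.operadicAnodyne A.ι) := by
  -- At the start `B = A`, and both members of every matched pair are missing because elements of
  -- `F` join missing faces.
  obtain ⟨N, B, rfl, hN, hB⟩ := hF.exists_filtration A le_rfl fun Q P h =>
    ⟨fun _ => (hF.missing Q P h.1).2.2, fun _ => (hF.missing Q P h.1).2.1⟩
  have key : ∀ K : Set Dendroidal.FaceKind, (∀ Q P, (Q, P) ∈ F → ∃ k ∈ K,
      Dendroidal.IsFaceOfKind k Q.1 P.1) →
      Dendroidal.saturation (Dendroidal.hornInclusions K) (B 0).ι := by
    intro K hK
    refine Dendroidal.saturation_ι_of_filtration N B hN fun i hi => ?_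
    obtain ⟨Q, P, hQP, hpush⟩ := hB i hi
    obtain ⟨k, hk, h⟩ := hK Q P hQP
    exact ⟨Q, P, k, hk, h, hpush⟩
  refine ⟨⟨N, B, rfl, hN, hB⟩, key _ fun Q P h => ?_, fun hk => key _ fun Q P h => ?_,
    fun hk => key _ fun Q P h => ⟨.inner, rfl, hk Q P h⟩⟩
  · obtain ⟨f, hf⟩ := (hF.missing Q P h).1
    exact ⟨f.kind, trivial, f, rfl, hf⟩
  · rcases hk Q P h with h | h
    · exact ⟨.inner, Or.inl rfl, h⟩
    · exact ⟨.top, Or.inr rfl, h⟩
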